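/- Let $d\ge 1$, let $\Omega\subset\mathbb R^d$ be a bounded open set (for instance a bounded Lipschitz domain), let $T>0$ and $I=(0,T)$. Let $H_0^1(\Omega)$ be the closure of $C_0^\infty(\Omega)$ in $H^1(\Omega)$, $H^{-1}(\Omega)$ its dual, $\Delta:H_0^1(\Omega)\to H^{-1}(\Omega)$ the distributional Laplacian, and $H^1_\star(I;H_0^1(\Omega))=\{v\in H^1(I;H_0^1(\Omega)) : v(0)=0\}$. Let $j_1:L^2(I;H_0^1(\Omega))\to\mathbb R$ and $j_2:H_0^1(\Omega)\to\mathbb R$ be continuously Fréchet differentiable, and identify $j_1'(v)$ with an element of $L^2(I;H^{-1}(\Omega))$. For $\rho>0$ let $|\cdot|_\rho:\mathbb R\to\mathbb R$ be an even convex function of class $C^{2,1}$ such that $|v|_\rho=|v|$ for $|v|\ge\rho$ and $|v|_\rho''\le 2/\rho$ for all $v\in\mathbb R$. For $\rho>0$ let $z_\rho\in H^1_\star(I;H_0^1(\Omega))$, and let $q_\rho\in H^1(I;H^{-1}(\Omega))$, $\xi_\rho\in L^2(I;H_0^1(\Omega))$ solve the regularized adjoint system $$-\dot q_\rho=\Delta\xi_\rho+j_1'(z_\rho),\qquad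 -\rho\,\Delta\xi_\rho+|\dot z_\rho|_\rho''\,\xi_\rho=q_\rho\qquad\text{in }H^{-1}(\Omega),\text{ a.e. on }I,\qquad q_\rho(T)=j_2'(z_\rho(T)).$$ Suppose that, as $\rho\searrow 0$ (through all $\rho>0$, or, more generally, along a fixed filter of positive parameters tending to $0$, such as that of a sequence $\rho_n\searrow0$), $z_\rho\to z$ in $H^1_\star(I;H_0^1(\Omega))$ and $q_\rho\rightharpoonup q$ weakly in $L^2(I;H^{-1}(\Omega))$. (Along a filter the adjoint system is needed only eventually.) Let $\phi\in L^2(I;C_0^\infty(\Omega))$, that is, $\phi(t)\in C_0^\infty(\Omega)$ for all $t$, $t\mapsto\phi(t,x)$ is measurable on $I$ for every $x$, and $t\mapsto\sup_{x}\|D_x^k\phi(t,x)\|$ belongs to $L^2(I)$ for every $k\ge0$. Then $\phi\,|\dot z|\in L^1(I;H_0^1(\Omega))$, the function $t\mapsto\langle q(t),\phi(t)\,|\dot z(t)|\rangle_{H^{-1}(\Omega),H_0^1(\Omega)}$ is integrable on $I$, and $$\langle q,\phi\,|\dot z|\rangle=\int_I\langle q(t),\phi(t)\,|\dot z(t)|\rangle_{H^{-1}(\Omega),H_0^1(\Omega)}\,dt=0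 .$$ -/

import Mathlib

open MeasureTheory Set Filter Topology TopologicalSpace
open scoped Gradient Distributions ContDiff

noncomputable section

namespace RateIndep

/-! ### Function spaces on the spatial domain -/

/-- Lebesgue measure on `Ω ⊆ ℝ^d`. -/
abbrev spaceMeasure {d : ℕ} (Ω : Opens (EuclideanSpace ℝ (Fin d))) :
    Measure (EuclideanSpace ℝ (Fin d)) :=
  volume.restrict (Ω : Set (EuclideanSpace ℝ (Fin d)))

/-- The Hilbert space `L²(Ω) × L²(Ω; ℝ^d)`, with norm `(‖u‖² + ‖G‖²)^{1/2}`; a function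
`u ∈ H¹(Ω)` is represented in it by the pair `(u, ∇u)`. -/
abbrev SobolevPair {d : ℕ} (Ω : Opens (EuclideanSpace ℝ (Fin d))) : Type :=
  WithLp 2 (Lp ℝ 2 (spaceMeasure Ω) × Lp (EuclideanSpace ℝ (Fin d)) 2 (spaceMeasure Ω))

lemma differentiable_testFunction {d : ℕ} {Ω : Opens (EuclideanSpace ℝ (Fin d))} (φ : 𝓓(Ω, ℝ)) :
    Differentiable ℝ (φ : EuclideanSpace ℝ (Fin d) → ℝ) :=
  φ.contDiff.differentiable (by simp)

/-- The pairs `(φ, ∇φ)` with `φ ∈ C_0^∞(Ω)`. -/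
def testPairs {d : ℕ} (Ω : Opens (EuclideanSpace ℝ (Fin d))) : Submodule ℝ (SobolevPair Ω) where
  carrier := {p | ∃ φ : 𝓓(Ω, ℝ),
    (p.fst : EuclideanSpace ℝ (Fin d) → ℝ) =ᵐ[spaceMeasure Ω] φ ∧
    (p.snd : EuclideanSpace ℝ (Fin d) → EuclideanSpace ℝ (Fin d)) =ᵐ[spaceMeasure Ω]
      fun x => ∇ (φ : EuclideanSpace ℝ (Fin d) → ℝ) x}
  add_mem' := by
    rintro p r ⟨φ, hφ, hφ'⟩ ⟨ψ, hψ, hψ'⟩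
    refine ⟨φ + ψ, ?_, ?_⟩
    · rw [WithLp.add_fst]
      filter_upwards [Lp.coeFn_add p.fst r.fst, hφ, hψ] with x h1 h2 h3
      rw [h1, Pi.add_apply, h2, h3]
      simp
    · rw [WithLp.add_snd]
      filter_upwards [Lp.coeFn_add p.snd r.snd, hφ', hψ'] with x h1 h2 h3
      have h4 : ((φ + ψ : 𝓓(Ω, ℝ)) : EuclideanSpace ℝ (Fin d) → ℝ)
          = (φ : EuclideanSpace ℝ (Fin d) → ℝ) + ψ := by ext; simp
      rw [h1, Pi.add_apply, h2, h3, h4, gradient, gradient, gradient,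
        fderiv_add (differentiable_testFunction φ x) (differentiable_testFunction ψ x), map_add]
  zero_mem' := by
    refine ⟨0, ?_, ?_⟩
    · rw [WithLp.zero_fst]
      filter_upwards [Lp.coeFn_zero ℝ 2 (spaceMeasure Ω)] with x h1
      rw [h1]
      simp
    · rw [WithLp.zero_snd]
      filter_upwards [Lp.coeFn_zero (EuclideanSpace ℝ (Fin d)) 2 (spaceMeasure Ω)] with x h1
      have h4 : ((0 : 𝓓(Ω, ℝ)) : EuclideanSpace ℝ (Fin d) → ℝ) = fun _ => 0 := by ext; simp
      rw [h1, h4, gradient_fun_const, Pi.zero_apply]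
  smul_mem' := by
    rintro c p ⟨φ, hφ, hφ'⟩
    refine ⟨c • φ, ?_, ?_⟩
    · rw [WithLp.smul_fst]
      filter_upwards [Lp.coeFn_smul c p.fst, hφ] with x h1 h2
      simp [h1, h2]
    · rw [WithLp.smul_snd]
      filter_upwards [Lp.coeFn_smul c p.snd, hφ'] with x h1 h2
      have h4 : ((c • φ : 𝓓(Ω, ℝ)) : EuclideanSpace ℝ (Fin d) → ℝ)
          = c • (φ : EuclideanSpace ℝ (Fin d) → ℝ) := by ext; simp
      rw [h1, Pi.smul_apply, h2, h4, gradient, gradient,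
        fderiv_const_smul (differentiable_testFunction φ x)]
      simp

/-- `H_0^1(Ω)`, the closure of `C_0^∞(Ω)` in the `H¹`-norm.  On a bounded `Ω` this norm is
equivalent to `‖∇ · ‖_{L²(Ω)}` (Poincaré), so that the topology, the dual space, and the notions of
convergence and differentiability are those of the gradient norm. -/
abbrev H01 {d : ℕ} (Ω : Opens (EuclideanSpace ℝ (Fin d))) : Type :=
  (testPairs Ω).topologicalClosure

/-- The function `u ∈ L²(Ω)` underlying `u ∈ H_0^1(Ω)`. -/
def H01.fn {d : ℕ} {Ω : Opens (EuclideanSpace ℝ (Fin d))} (u : H01 Ω) : Lp ℝ 2 (spaceMeasure Ω) :=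
  (u : SobolevPair Ω).fst

/-- The weak gradient, as a bounded linear operator `H_0^1(Ω) → L²(Ω; ℝ^d)`. -/
def gradL {d : ℕ} (Ω : Opens (EuclideanSpace ℝ (Fin d))) :
    H01 Ω →L[ℝ] Lp (EuclideanSpace ℝ (Fin d)) 2 (spaceMeasure Ω) :=
  (WithLp.sndL 2 ℝ _ _).comp (testPairs Ω).topologicalClosure.subtypeL

/-- `H^{-1}(Ω)`, the dual space of `H_0^1(Ω)`; the duality pairing of `q` and `v` is `q v`. -/
abbrev Hneg {d : ℕ} (Ω : Opens (EuclideanSpace ℝ (Fin d))) : Type := StrongDual ℝ (H01 Ω)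

/-- The distributional Laplacian `H_0^1(Ω) → H^{-1}(Ω)`, `⟨Δu, v⟩ = -∫_Ω ∇u · ∇v`. -/
def laplacian {d : ℕ} {Ω : Opens (EuclideanSpace ℝ (Fin d))} (u : H01 Ω) : Hneg Ω :=
  -((innerSL ℝ (gradL Ω u)).comp (gradL Ω))

lemma laplacian_apply {d : ℕ} {Ω : Opens (EuclideanSpace ℝ (Fin d))} (u v : H01 Ω) :
    laplacian u v = -∫ x in Ω, inner ℝ (gradL Ω u x) (gradL Ω v x) := by
  simp [laplacian, L2.inner_def]

/-! ### Bochner spaces on the time interval `I = (0, T)` -/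

/-- Lebesgue measure on `I = (0, T)`. -/
abbrev timeMeasure (T : ℝ) : Measure ℝ := volume.restrict (Ioo 0 T)

/-- The Bochner space `L²(I; H)`. -/
abbrev L2I (T : ℝ) (H : Type) [NormedAddCommGroup H] : Type := Lp H 2 (timeMeasure T)

section Bochner

set_option linter.unusedSectionVars false

variable {T : ℝ} {H : Type} [NormedAddCommGroup H] [NormedSpace ℝ H]

/-- `v'` is the weak derivative of `v` on `I = (0, T)`. -/
def HasWeakDeriv (v v' : L2I T H) : Prop :=
  ∀ η : 𝓓((⟨Ioo 0 T, isOpen_Ioo⟩ : Opens ℝ), ℝ),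
    ∫ t in Ioo 0 T, deriv η t • v t = -∫ t in Ioo 0 T, η t • v' t

/-- The continuous representative of `v` on `[0, T]` takes the value `a` at `t`. -/
def HasTrace (v : L2I T H) (t : ℝ) (a : H) : Prop :=
  ∃ c : ℝ → H, ContinuousOn c (Icc 0 T) ∧ c =ᵐ[timeMeasure T] v ∧ c t = a

lemma integrable_smul_L2I {g : ℝ → ℝ} (hg : Continuous g) (hc : HasCompactSupport g)
    (v : L2I T H) : Integrable (fun t => g t • v t) (timeMeasure T) := by
  obtain ⟨C, hC⟩ := hc.exists_bound_of_continuous hg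
  exact ((Lp.memLp v).integrable (by norm_num)).bdd_smul C hg.aestronglyMeasurable
    (Eventually.of_forall hC)

lemma integrable_deriv_smul (η : 𝓓((⟨Ioo 0 T, isOpen_Ioo⟩ : Opens ℝ), ℝ)) (v : L2I T H) :
    Integrable (fun t => deriv η t • v t) (timeMeasure T) :=
  integrable_smul_L2I (η.contDiff.continuous_deriv (by simp)) η.hasCompactSupport.deriv v

lemma integrable_test_smul (η : 𝓓((⟨Ioo 0 T, isOpen_Ioo⟩ : Opens ℝ), ℝ)) (v : L2I T H) :
    Integrable (fun t => η t • v t) (timeMeasure T) :=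
  integrable_smul_L2I η.contDiff.continuous η.hasCompactSupport v

lemma HasWeakDeriv.add {v v' w w' : L2I T H} (hv : HasWeakDeriv v v') (hw : HasWeakDeriv w w') :
    HasWeakDeriv (v + w) (v' + w') := by
  intro η
  have h1 : ∫ t in Ioo 0 T, deriv η t • (v + w : L2I T H) t
      = ∫ t in Ioo 0 T, (deriv η t • v t + deriv η t • w t) := by
    refine integral_congr_ae ?_
    filter_upwards [Lp.coeFn_add v w] with t ht
    rw [ht, Pi.add_apply, smul_add]
  have h2 : ∫ t in Ioo 0 T, η t • (v' + w' : L2I T H) t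
      = ∫ t in Ioo 0 T, (η t • v' t + η t • w' t) := by
    refine integral_congr_ae ?_
    filter_upwards [Lp.coeFn_add v' w'] with t ht
    rw [ht, Pi.add_apply, smul_add]
  rw [h1, h2, integral_add (integrable_deriv_smul η v) (integrable_deriv_smul η w),
    integral_add (integrable_test_smul η v') (integrable_test_smul η w'), hv η, hw η, neg_add]

lemma HasWeakDeriv.smul {v v' : L2I T H} (c : ℝ) (hv : HasWeakDeriv v v') :
    HasWeakDeriv (c • v) (c • v') := by
  intro η
  have h1 : ∫ t in Ioo 0 T, deriv η t • (c • v : L2I T H) t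
      = ∫ t in Ioo 0 T, c • (deriv η t • v t) := by
    refine integral_congr_ae ?_
    filter_upwards [Lp.coeFn_smul c v] with t ht
    rw [ht, Pi.smul_apply, smul_comm]
  have h2 : ∫ t in Ioo 0 T, η t • (c • v' : L2I T H) t
      = ∫ t in Ioo 0 T, c • (η t • v' t) := by
    refine integral_congr_ae ?_
    filter_upwards [Lp.coeFn_smul c v'] with t ht
    rw [ht, Pi.smul_apply, smul_comm]
  rw [h1, h2, integral_smul, integral_smul, hv η, smul_neg]

lemma HasTrace.add {v w : L2I T H} {t : ℝ} {a b : H} (hv : HasTrace v t a)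
    (hw : HasTrace w t b) : HasTrace (v + w) t (a + b) := by
  obtain ⟨c, hc, hc', rfl⟩ := hv
  obtain ⟨e, he, he', rfl⟩ := hw
  refine ⟨c + e, hc.add he, ?_, rfl⟩
  filter_upwards [Lp.coeFn_add v w, hc', he'] with s h1 h2 h3
  rw [h1, Pi.add_apply, Pi.add_apply, h2, h3]

lemma HasTrace.smul {v : L2I T H} {t : ℝ} {a : H} (r : ℝ) (hv : HasTrace v t a) :
    HasTrace (r • v) t (r • a) := by
  obtain ⟨c, hc, hc', rfl⟩ := hv
  refine ⟨r • c, hc.const_smul r, ?_, rfl⟩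
  filter_upwards [Lp.coeFn_smul r v, hc'] with s h1 h2
  rw [h1, Pi.smul_apply, Pi.smul_apply, h2]

lemma hasTrace_zero (t : ℝ) : HasTrace (0 : L2I T H) t 0 :=
  ⟨0, continuousOn_const, (Lp.coeFn_zero H 2 (timeMeasure T)).symm, rfl⟩

lemma hasWeakDeriv_zero : HasWeakDeriv (0 : L2I T H) 0 := by
  intro η
  have h (g : ℝ → ℝ) : ∫ t in Ioo 0 T, g t • (0 : L2I T H) t = 0 := by
    refine integral_eq_zero_of_ae ?_
    filter_upwards [Lp.coeFn_zero H 2 (timeMeasure T)] with t ht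
    rw [ht, Pi.zero_apply, smul_zero]
  rw [h, h, neg_zero]

end Bochner

/-- The Bochner--Sobolev space `H¹(I; H)`: pairs `(v, v̇)` of elements of `L²(I; H)` where `v̇` is
the weak derivative of `v`, with the norm `(‖v‖² + ‖v̇‖²)^{1/2}`. -/
def H1I (T : ℝ) (H : Type) [NormedAddCommGroup H] [NormedSpace ℝ H] :
    Submodule ℝ (WithLp 2 (L2I T H × L2I T H)) where
  carrier := {p | HasWeakDeriv p.fst p.snd}
  add_mem' := fun hp hr => HasWeakDeriv.add hp hr
  zero_mem' := hasWeakDeriv_zero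
  smul_mem' := fun c _ hp => HasWeakDeriv.smul c hp

/-- `H¹_⋆(I; H) = {v ∈ H¹(I; H) : v(0) = 0}`. -/
def H1IStar (T : ℝ) (H : Type) [NormedAddCommGroup H] [NormedSpace ℝ H] :
    Submodule ℝ (WithLp 2 (L2I T H × L2I T H)) where
  carrier := {p | HasWeakDeriv p.fst p.snd ∧ HasTrace p.fst 0 0}
  add_mem' := fun hp hr =>
    ⟨HasWeakDeriv.add hp.1 hr.1, by simpa using HasTrace.add hp.2 hr.2⟩
  zero_mem' := ⟨hasWeakDeriv_zero, hasTrace_zero 0⟩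
  smul_mem' := fun c _ hp => ⟨HasWeakDeriv.smul c hp.1, by simpa using HasTrace.smul c hp.2⟩

/-- The function `v ∈ L²(I; H)` underlying `v ∈ H¹(I; H)`. -/
def H1I.fn {T : ℝ} {H : Type} [NormedAddCommGroup H] [NormedSpace ℝ H] (v : H1I T H) : L2I T H :=
  (v : WithLp 2 (L2I T H × L2I T H)).fst

/-- The time derivative `v̇ ∈ L²(I; H)` of `v ∈ H¹(I; H)`. -/
def H1I.dot {T : ℝ} {H : Type} [NormedAddCommGroup H] [NormedSpace ℝ H] (v : H1I T H) : L2I T H :=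
  (v : WithLp 2 (L2I T H × L2I T H)).snd

/-- The function `v ∈ L²(I; H)` underlying `v ∈ H¹_⋆(I; H)`. -/
def H1IStar.fn {T : ℝ} {H : Type} [NormedAddCommGroup H] [NormedSpace ℝ H] (v : H1IStar T H) :
    L2I T H :=
  (v : WithLp 2 (L2I T H × L2I T H)).fst

/-- The time derivative `v̇ ∈ L²(I; H)` of `v ∈ H¹_⋆(I; H)`. -/
def H1IStar.dot {T : ℝ} {H : Type} [NormedAddCommGroup H] [NormedSpace ℝ H] (v : H1IStar T H) :
    L2I T H :=
  (v : WithLp 2 (L2I T H × L2I T H)).snd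

/-- `f ∈ L²(I; H^{-1}(Ω))` represents the bounded functional `F` on `L²(I; H_0^1(Ω))`, i.e.
`F v = ∫_I ⟨f(t), v(t)⟩ dt`; this is the identification of the dual of `L²(I; H_0^1(Ω))` with
`L²(I; H^{-1}(Ω))`. -/
def Represents {d : ℕ} {Ω : Opens (EuclideanSpace ℝ (Fin d))} {T : ℝ}
    (f : L2I T (Hneg Ω)) (F : StrongDual ℝ (L2I T (H01 Ω))) : Prop :=
  ∀ v : L2I T (H01 Ω), F v = ∫ t in Ioo 0 T, f t (v t)

/-- `φ ∈ L²(I; C_0^∞(Ω))`: `φ(t) ∈ C_0^∞(Ω)` for every `t`, `φ` is measurable in time, and the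
supremum over `Ω` of each spatial derivative is square integrable in time. -/
structure IsL2TestFunction {d : ℕ} {Ω : Opens (EuclideanSpace ℝ (Fin d))} (T : ℝ)
    (φ : ℝ → 𝓓(Ω, ℝ)) : Prop where
  aemeasurable : ∀ x, AEMeasurable (fun t => φ t x) (timeMeasure T)
  memLp : ∀ k : ℕ, MemLp (fun t => ⨆ x, ‖iteratedFDeriv ℝ k (φ t) x‖) 2 (timeMeasure T)

/-! ### Regularized modulus and adjoint system -/

/-- The assumptions on the regularization `a ρ v = |v|_ρ` (`ρ > 0`) of the modulus. -/
structure IsRegularizedAbs (a : ℝ → ℝ → ℝ) : Prop where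
  contDiff : ∀ ρ > 0, ContDiff ℝ 2 (a ρ)
  lipschitz : ∀ ρ > 0, ∃ K, LipschitzWith K (deriv (deriv (a ρ)))
  convex : ∀ ρ > 0, ConvexOn ℝ univ (a ρ)
  even : ∀ ρ > 0, ∀ v, a ρ v = a ρ (-v)
  eq_abs : ∀ ρ > 0, ∀ v, ρ ≤ |v| → a ρ v = |v|
  deriv2_le : ∀ ρ > 0, ∀ v, deriv (deriv (a ρ)) v ≤ 2 / ρ

/-- `(q, ξ)` solves the regularized adjoint system with parameter `ρ` and state `z`:
`-q̇ = Δξ + j₁'(z)` and `-ρ Δξ + |ż|_ρ'' ξ = q` in `H^{-1}(Ω)` a.e. on `I`, and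
`q(T) = j₂'(z(T))`. -/
structure IsAdjointSolution {d : ℕ} {Ω : Opens (EuclideanSpace ℝ (Fin d))} {T : ℝ}
    (a : ℝ → ℝ → ℝ) (j₁ : L2I T (H01 Ω) → ℝ) (j₂ : H01 Ω → ℝ) (ρ : ℝ)
    (z : H1IStar T (H01 Ω)) (q : H1I T (Hneg Ω)) (ξ : L2I T (H01 Ω)) : Prop where
  evolution : ∃ f : L2I T (Hneg Ω), Represents f (fderiv ℝ j₁ (H1IStar.fn z)) ∧
    ∀ᵐ t ∂timeMeasure T, -(H1I.dot q t) = laplacian (ξ t) + f t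
  terminal : ∃ zT : H01 Ω, HasTrace (H1IStar.fn z) T zT ∧ HasTrace (H1I.fn q) T (fderiv ℝ j₂ zT)
  elliptic : ∀ᵐ t ∂timeMeasure T, ∀ v : H01 Ω,
    -ρ * laplacian (ξ t) v +
      ∫ x in Ω, deriv (deriv (a ρ)) (H01.fn (H1IStar.dot z t) x) * H01.fn (ξ t) x * H01.fn v x
    = H1I.fn q t v

end RateIndep

end

/-!
The function `w = φ |ż|` lies in `H_0^1(Ω)` at almost every time, with gradient `|ż| ∇φ + φ sgn(ż)
∇ż`, and `‖w‖ ≤ 3 N ‖ż‖`, where `N ∈ L²(I)` bounds `φ` and `∇φ`. It has to be shown that the weak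
limit `q` of the adjoint variables `q_ρ` annihilates it.

The elliptic equation says that this is nearly so for `q_ρ` and `ż_ρ`. The quantity `⟨q_ρ, ξ_ρ⟩ =
ρ ‖∇ξ_ρ‖² + ∫_Ω |ż_ρ|_ρ'' ξ_ρ²` is nonnegative, and if `v` is a bounded multiple of a function
dominated by `|ż_ρ|`, then `⟨q_ρ, v⟩ = ρ (∇ξ_ρ, ∇v) + ∫_Ω |ż_ρ|_ρ'' ξ_ρ v` is of order `√ρ` in
terms of `⟨q_ρ, ξ_ρ⟩` and `‖v‖²`: the weight `|ż_ρ|_ρ'' ≤ 2/ρ` lives on `{|ż_ρ| ≤ ρ}`, where `|v|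
≤ C ρ` (`IsAdjointSolution.abs_apply_le`). Uniform bounds for `∫_I ⟨q_ρ, ξ_ρ⟩` and for `q_ρ` in
`L^∞(I; H^{-1}(Ω))` come from testing the evolution equation with `(-Δ)⁻¹ q_ρ`
(`IsAdjointSolution.energy_estimate`). This uses the Poincaré inequality, for the inverse of `-Δ`,
and the fact that the continuous representative of a weakly differentiable function is the
primitive of its derivative (`HasWeakDeriv.sub_eq_integral`), for the chain rule in time.

To let `ρ → 0`, strong convergence of the test functions is needed, because `q_ρ` converges only
weakly. The map `u ↦ φ g(u)` on `H_0^1(Ω)` is continuous if `g` and `g'` are continuous with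
`|g(v)| ≤ |v|` and `|g'| ≤ 1` (`continuous_modPair`), as a superposition operator on `L²`
(`tendsto_eLpNorm_superposition`). It is used with a smooth approximation `g = |·|_ε` of the
modulus and with `φ` cut off in time at the level `N ≤ c`, which gives a continuous superposition
operator on `L²(I; H_0^1(Ω))` and hence `∫_I ⟨q, v⟩ = 0` for `v = 1_{N ≤ c} φ |ż|_ε`
(`integral_apply_truncProd_eq_zero`). Finally `ε → 0` and `c → ∞` by dominated convergence
(`exists_toLp_integral_pairing_eq_zero`), where the bound of `q` in `L^∞(I; H^{-1}(Ω))` supplies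
the integrable majorant; that bound passes to the weak limit by `ae_norm_le_of_weak_limit`.
-/

noncomputable section

namespace RateIndep

/-! ### Weak derivatives in time -/

lemma exists_Icc_superset_of_isCompact {K : Set ℝ} {T : ℝ} (hT : 0 < T) (hK : IsCompact K)
    (h : K ⊆ Ioo 0 T) : ∃ a b, 0 < a ∧ b < T ∧ K ⊆ Icc a b := by
  rcases K.eq_empty_or_nonempty with rfl | hne
  · exact ⟨T, 0, hT, hT, empty_subset _⟩
  · obtain ⟨a, ha⟩ := hK.exists_isLeast hne
    obtain ⟨b, hb⟩ := hK.exists_isGreatest hne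
    exact ⟨a, b, (h ha.1).1, (h hb.1).2, fun x hx => ⟨ha.2 hx, hb.2 hx⟩⟩

/-- A test function on `(0, T)` of mean zero is the derivative of a test function. -/
lemma exists_testFunction_deriv_eq {T : ℝ} (hT : 0 < T) {ψ : ℝ → ℝ} (hψ : ContDiff ℝ ∞ ψ)
    (hc : HasCompactSupport ψ) (hs : tsupport ψ ⊆ Ioo 0 T) (h0 : ∫ t in (0 : ℝ)..T, ψ t = 0) :
    ∃ η : 𝓓((⟨Ioo 0 T, isOpen_Ioo⟩ : Opens ℝ), ℝ), deriv η = ψ := by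
  obtain ⟨a, b, ha, hb, hab⟩ := exists_Icc_superset_of_isCompact hT hc hs
  have hzero : ∀ x, x ∉ Icc a b → ψ x = 0 := fun x hx =>
    image_eq_zero_of_notMem_tsupport fun h => hx (hab h)
  have hderiv : ∀ x, HasDerivAt (fun x => ∫ t in (0 : ℝ)..x, ψ t) (ψ x) x := fun x =>
    intervalIntegral.integral_hasDerivAt_right (hψ.continuous.intervalIntegrable _ _)
      (hψ.continuous.stronglyMeasurableAtFilter _ _) hψ.continuous.continuousAt
  have hd : deriv (fun x => ∫ t in (0 : ℝ)..x, ψ t) = ψ := funext fun x => (hderiv x).deriv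
  have hout : ∀ x, x ∉ Icc a b → ∫ t in (0 : ℝ)..x, ψ t = 0 := by
    intro x hx
    rcases lt_or_ge x a with hxa | hxa
    · rw [intervalIntegral.integral_congr (g := fun _ => (0 : ℝ))]
      · simp
      · intro t ht
        refine hzero t fun h => ?_
        have := ht.2
        have h1 := h.1
        rcases le_max_iff.1 this with h2 | h2 <;> linarith
    · have hxb : b < x := by
        by_contra h
        exact hx ⟨hxa, not_lt.1 h⟩
      have h1 := intervalIntegral.integral_add_adjacent_intervals
        (hψ.continuous.intervalIntegrable (μ := volume) 0 x)
        (hψ.continuous.intervalIntegrable x T)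
      have h2 : ∫ t in x..T, ψ t = 0 := by
        rw [intervalIntegral.integral_congr (g := fun _ => (0 : ℝ))]
        · simp
        · intro t ht
          refine hzero t fun h => ?_
          have := ht.1
          have h1 := h.2
          rcases min_le_iff.1 this with h2 | h2 <;> linarith
      rw [h2, add_zero] at h1
      rw [h1, h0]
  refine ⟨⟨fun x => ∫ t in (0 : ℝ)..x, ψ t, ?_, ?_, ?_⟩, hd⟩
  · have : ContDiff ℝ ∞ (fun x => ∫ t in (0 : ℝ)..x, ψ t) :=
      contDiff_infty_iff_deriv.2 ⟨fun x => (hderiv x).differentiableAt, by rwa [hd]⟩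
    exact this
  · exact HasCompactSupport.intro isCompact_Icc hout
  · refine (closure_minimal (fun x hx => ?_) isClosed_Icc).trans
      (Icc_subset_Ioo ha hb)
    by_contra h
    exact hx (hout x h)

/-- **Du Bois-Reymond lemma**: a continuous function on `[0, T]` with vanishing weak derivative
is constant. -/
lemma eq_of_integral_deriv_mul_eq_zero {T : ℝ} (hT : 0 < T) {h : ℝ → ℝ}
    (hc : ContinuousOn h (Icc 0 T))
    (hη : ∀ η : 𝓓((⟨Ioo 0 T, isOpen_Ioo⟩ : Opens ℝ), ℝ), ∫ t in Ioo 0 T, deriv η t * h t = 0)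
    {s t : ℝ} (hs : s ∈ Icc 0 T) (ht : t ∈ Icc 0 T) : h s = h t := by
  let f : ContDiffBump (T / 2) := ⟨T / 8, T / 4, by positivity, by linarith⟩
  have hint : IntegrableOn h (Ioo 0 T) :=
    (hc.integrableOn_Icc).mono_set Ioo_subset_Icc_self
  have hfs : tsupport (f.normed volume) ⊆ Ioo 0 T := by
    rw [f.tsupport_normed_eq, Real.closedBall_eq_Icc]
    refine Icc_subset_Ioo ?_ ?_ <;> simp only [f] <;> linarith
  have hfc : ContDiff ℝ ∞ (f.normed volume) := f.contDiff_normed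
  have hsupp : ∀ {g : ℝ → ℝ}, tsupport g ⊆ Ioo 0 T → ∫ t in Ioo 0 T, g t = ∫ t, g t := by
    intro g hg
    exact setIntegral_eq_integral_of_forall_compl_eq_zero fun x hx =>
      image_eq_zero_of_notMem_tsupport fun h => hx (hg h)
  have hmul : ∀ {g : ℝ → ℝ}, ContDiff ℝ ∞ g → HasCompactSupport g →
      IntegrableOn (fun t => g t * h t) (Ioo 0 T) := by
    intro g hg hgc
    obtain ⟨C, hC⟩ := hgc.exists_bound_of_continuous hg.continuous
    exact hint.bdd_mul hg.continuous.aestronglyMeasurable (Eventually.of_forall hC)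
  -- The constant value of `h` is its mean against the fixed bump function `f`.
  set k := ∫ t in Ioo 0 T, f.normed volume t * h t with hk
  have hae : ∀ᵐ x, x ∈ Ioo 0 T → h x - k = 0 := by
    refine isOpen_Ioo.ae_eq_zero_of_integral_contDiff_smul_eq_zero
      (hint.sub (integrableOn_const (by simp))).locallyIntegrableOn ?_
    intro g hg hgc hgs
    set m := ∫ t, g t with hm
    -- `g - m f` has mean zero, hence is an admissible derivative.
    have hψ : ContDiff ℝ ∞ (fun t => g t - m * f.normed volume t) :=
      hg.sub (contDiff_const.mul hfc)
    have hψc : HasCompactSupport (fun t => g t - m * f.normed volume t) :=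
      hgc.sub (f.hasCompactSupport_normed.mul_left)
    have hψs : tsupport (fun t => g t - m * f.normed volume t) ⊆ Ioo 0 T := by
      refine (tsupport_sub g (fun t => m * f.normed volume t)).trans (union_subset hgs ?_)
      exact (tsupport_mul_subset_right (f := fun _ => m)).trans hfs
    have h0 : ∫ t in (0 : ℝ)..T, (g t - m * f.normed volume t) = 0 := by
      rw [intervalIntegral.integral_of_le hT.le, integral_Ioc_eq_integral_Ioo, hsupp hψs,
        integral_sub (hg.continuous.integrable_of_hasCompactSupport hgc)
          ((hfc.continuous.integrable_of_hasCompactSupport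
            f.hasCompactSupport_normed).const_mul m), integral_const_mul, f.integral_normed]
      simp [hm]
    obtain ⟨η, hη'⟩ := exists_testFunction_deriv_eq hT hψ hψc hψs h0
    have h1 := hη η
    have h2 : ∫ t in Ioo 0 T, g t * h t = m * k := by
      rw [hk, ← sub_eq_zero, ← integral_const_mul, ← integral_sub (hmul hg hgc)
        ((hmul hfc f.hasCompactSupport_normed).const_mul m)]
      refine Eq.trans (integral_congr_ae (Eventually.of_forall fun t => ?_)) h1
      simp only [hη']
      ring
    rw [← hsupp ((tsupport_smul_subset_left g _).trans hgs)]
    simp only [smul_eq_mul, mul_sub]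
    rw [integral_sub (hmul hg hgc)
      ((hg.continuous.integrable_of_hasCompactSupport hgc).integrableOn.mul_const k), h2,
      integral_mul_const, hsupp hgs, sub_self]
  have hall : ∀ x ∈ Icc 0 T, h x = k := by
    have hioo : EqOn h (fun _ => k) (Ioo 0 T) := by
      refine Measure.eqOn_open_of_ae_eq (μ := volume) ?_ isOpen_Ioo
        (hc.mono Ioo_subset_Icc_self) continuousOn_const
      rw [EventuallyEq, ae_restrict_iff' measurableSet_Ioo]
      filter_upwards [hae] with x hx hx'
      exact sub_eq_zero.1 (hx hx')
    have := hioo.of_subset_closure hc continuousOn_const Ioo_subset_Icc_self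
      (closure_Ioo hT.ne).ge
    exact this
  rw [hall s hs, hall t ht]

lemma L2I.intervalIntegrable {T : ℝ} {H : Type} [NormedAddCommGroup H] (v : L2I T H)
    (hT : 0 < T) : IntervalIntegrable v volume 0 T := by
  rw [intervalIntegrable_iff_integrableOn_Ioo_of_le hT.le]
  exact (Lp.memLp v).integrable (by norm_num)

/-- The continuous representative of a function with a square integrable weak derivative is the
primitive of the weak derivative. -/
lemma HasWeakDeriv.sub_eq_integral {T : ℝ} {H : Type} [NormedAddCommGroup H] [NormedSpace ℝ H]
    [CompleteSpace H] (hT : 0 < T) {v v' : L2I T H} (hv : HasWeakDeriv v v') {c : ℝ → H}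
    (hc : ContinuousOn c (Icc 0 T)) (hcv : c =ᵐ[timeMeasure T] v) {t : ℝ} (ht : t ∈ Icc 0 T) :
    c t - c 0 = ∫ s in (0 : ℝ)..t, v' s := by
  -- Bounded functionals reduce the claim to the scalar case, where `F ∘ c` is compared with the
  -- absolutely continuous function `p`.
  refine (SeparatingDual.eq_iff_forall_dual_eq (R := ℝ)).2 fun F => ?_
  have hv'i := L2I.intervalIntegrable v' hT
  have hsub : ∀ {t}, t ∈ Icc 0 T → uIcc 0 t ⊆ uIcc 0 T := fun {t} ht => by
    rw [uIcc_of_le ht.1, uIcc_of_le hT.le]; exact Icc_subset_Icc_right ht.2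
  have hFi : IntervalIntegrable (fun s => F (v' s)) volume 0 T :=
    ⟨F.integrable_comp hv'i.1, F.integrable_comp hv'i.2⟩
  set p : ℝ → ℝ := fun t => ∫ s in (0 : ℝ)..t, F (v' s) with hp
  have hpac : AbsolutelyContinuousOnInterval p 0 T :=
    hFi.absolutelyContinuousOnInterval_intervalIntegral (by simp)
  have hpc : ContinuousOn p (Icc 0 T) := by
    simpa [uIcc_of_le hT.le] using hpac.continuousOn
  have hFc : ContinuousOn (fun t => F (c t)) (Icc 0 T) := F.continuous.comp_continuousOn hc
  have key : ∀ η : 𝓓((⟨Ioo 0 T, isOpen_Ioo⟩ : Opens ℝ), ℝ),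
      ∫ t in Ioo 0 T, deriv η t * (F (c t) - p t) = 0 := by
    intro η
    obtain ⟨C, hC⟩ := η.hasCompactSupport.deriv.exists_bound_of_continuous
      (η.contDiff.continuous_deriv (by simp))
    have hmul : ∀ {g : ℝ → ℝ}, ContinuousOn g (Icc 0 T) →
        IntegrableOn (fun t => deriv η t * g t) (Ioo 0 T) := by
      intro g hg
      exact (hg.integrableOn_Icc.mono_set Ioo_subset_Icc_self).bdd_mul
        (η.contDiff.continuous_deriv (by simp)).aestronglyMeasurable (Eventually.of_forall hC)
    have h1 : ∫ t in Ioo 0 T, deriv η t * F (c t) = -∫ t in Ioo 0 T, η t * F (v' t) := by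
      have := congrArg F (hv η)
      rw [map_neg, ← F.integral_comp_comm (integrable_deriv_smul η v),
        ← F.integral_comp_comm (integrable_test_smul η v')] at this
      simp only [map_smul, smul_eq_mul] at this
      rw [← this]
      refine integral_congr_ae ?_
      filter_upwards [hcv] with t ht
      rw [ht]
    have h2 : ∫ t in Ioo 0 T, deriv η t * p t = -∫ t in Ioo 0 T, η t * F (v' t) := by
      have hηac : AbsolutelyContinuousOnInterval (η : ℝ → ℝ) 0 T :=
        ContDiffOn.absolutelyContinuousOnInterval
          ((η.contDiff.of_le (by simp)).contDiffOn)
      have h3 := hηac.integral_mul_deriv_eq_deriv_mul hpac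
      have hη0 : η 0 = 0 := image_eq_zero_of_notMem_tsupport fun h => by
        simpa using η.tsupport_subset h
      have hηT : η T = 0 := image_eq_zero_of_notMem_tsupport fun h => by
        simpa using η.tsupport_subset h
      have h4 : ∫ t in (0 : ℝ)..T, η t * deriv p t = ∫ t in (0 : ℝ)..T, η t * F (v' t) := by
        refine intervalIntegral.integral_congr_ae ?_
        filter_upwards [hFi.ae_hasDerivAt_integral] with t ht htm
        rw [(ht (uIoc_subset_uIcc htm) 0 (by simp)).deriv]
      rw [hη0, hηT, h4] at h3
      simp only [intervalIntegral.integral_of_le hT.le, integral_Ioc_eq_integral_Ioo] at h3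
      linarith
    simp only [mul_sub]
    rw [integral_sub (hmul hFc) (hmul hpc), h1, h2, sub_self]
  have h := eq_of_integral_deriv_mul_eq_zero hT (hFc.sub hpc) key ht (left_mem_Icc.2 hT.le)
  have h0 : p 0 = 0 := by simp [hp]
  simp only [Pi.sub_apply, h0] at h
  have h5 : F (∫ s in (0 : ℝ)..t, v' s) = p t :=
    (F.intervalIntegral_comp_comm (hv'i.mono_set (hsub ht))).symm
  rw [map_sub, h5]
  linarith

/-- A curve whose increments are dominated by those of an absolutely continuous curve is
absolutely continuous. -/
lemma absolutelyContinuousOnInterval_of_dist_le {X Y : Type*} [PseudoMetricSpace X]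
    [PseudoMetricSpace Y] {f : ℝ → X} {g : ℝ → Y} {a b K : ℝ}
    (hg : AbsolutelyContinuousOnInterval g a b)
    (h : ∀ x ∈ uIcc a b, ∀ y ∈ uIcc a b, dist (f x) (f y) ≤ K * dist (g x) (g y)) :
    AbsolutelyContinuousOnInterval f a b := by
  have h0 := Tendsto.const_mul K hg
  rw [mul_zero] at h0
  refine squeeze_zero' (Eventually.of_forall fun E => Finset.sum_nonneg fun _ _ => dist_nonneg)
    ?_ h0
  refine eventually_inf_principal.2 (Eventually.of_forall fun E hE => ?_)
  rw [Finset.mul_sum]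
  refine Finset.sum_le_sum fun i hi => ?_
  have := hE.1 i hi
  exact h _ this.1 _ this.2

/-- The chain rule for a symmetric bilinear form along a primitive `c` of an integrable
function `g`. -/
lemma bilin_sub_eq_integral {T : ℝ} {H : Type} [NormedAddCommGroup H] [NormedSpace ℝ H]
    [CompleteSpace H] (hT : 0 < T) {g : ℝ → H} (hg : IntervalIntegrable g volume 0 T)
    {c : ℝ → H} (hc : ∀ t ∈ Icc 0 T, c t - c 0 = ∫ s in (0 : ℝ)..t, g s)
    (B : H →L[ℝ] H →L[ℝ] ℝ) (hB : ∀ x y, B x y = B y x) {t : ℝ} (ht : t ∈ Icc 0 T) :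
    B (c T) (c T) - B (c t) (c t) = 2 * ∫ s in t..T, B (g s) (c s) := by
  have huIcc : uIcc 0 T = Icc 0 T := uIcc_of_le hT.le
  have hint : ∀ {x y}, x ∈ Icc 0 T → y ∈ Icc 0 T → IntervalIntegrable g volume x y :=
    fun hx hy => hg.mono_set (by rw [huIcc]; exact uIcc_subset_Icc hx hy)
  have h0 : (0 : ℝ) ∈ Icc 0 T := left_mem_Icc.2 hT.le
  have hP : AbsolutelyContinuousOnInterval (fun t => ∫ s in (0 : ℝ)..t, ‖g s‖) 0 T :=
    hg.norm.absolutelyContinuousOnInterval_intervalIntegral (by simp)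
  have hdist : ∀ x ∈ uIcc 0 T, ∀ y ∈ uIcc 0 T, dist (c x) (c y) ≤
      1 * dist (∫ s in (0 : ℝ)..x, ‖g s‖) (∫ s in (0 : ℝ)..y, ‖g s‖) := by
    rw [huIcc]
    intro x hx y hy
    have h1 : c x - c y = ∫ s in y..x, g s := by
      rw [← intervalIntegral.integral_interval_sub_left (hint h0 hx) (hint h0 hy),
        ← hc x hx, ← hc y hy]
      abel
    rw [one_mul, dist_eq_norm, h1, Real.dist_eq,
      intervalIntegral.integral_interval_sub_left (hint h0 hx).norm (hint h0 hy).norm]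
    exact intervalIntegral.norm_integral_le_abs_integral_norm
  have hcac := absolutelyContinuousOnInterval_of_dist_le hP hdist
  obtain ⟨M, hM⟩ := hcac.exists_bound
  have heac : AbsolutelyContinuousOnInterval (fun t => B (c t) (c t)) 0 T := by
    refine absolutelyContinuousOnInterval_of_dist_le hcac (K := 2 * ‖B‖ * M) ?_
    intro x hx y hy
    have h1 : B (c x) (c x) - B (c y) (c y) = B (c x - c y) (c x) + B (c x - c y) (c y) := by
      rw [map_sub, sub_apply, sub_apply, hB (c y) (c x)]
      ring
    have h2 := B.le_opNorm₂ (c x - c y) (c x)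
    have h3 := B.le_opNorm₂ (c x - c y) (c y)
    have h4 : ‖B‖ * ‖c x - c y‖ * ‖c x‖ ≤ ‖B‖ * ‖c x - c y‖ * M := by
      gcongr; exact hM x hx
    have h5 : ‖B‖ * ‖c x - c y‖ * ‖c y‖ ≤ ‖B‖ * ‖c x - c y‖ * M := by
      gcongr; exact hM y hy
    rw [Real.dist_eq, h1, dist_eq_norm, ← Real.norm_eq_abs]
    refine (norm_add_le _ _).trans ?_
    linarith
  have hT' : T ∈ Icc 0 T := right_mem_Icc.2 hT.le
  have hsub : uIcc t T ⊆ uIcc 0 T := by rw [huIcc]; exact uIcc_subset_Icc ht hT'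
  rw [← (heac.mono hsub).integral_deriv_eq_sub, ← intervalIntegral.integral_const_mul]
  refine intervalIntegral.integral_congr_ae ?_
  have hne0 : ∀ᵐ x : ℝ, x ≠ T := by simp [ae_iff, measure_singleton]
  filter_upwards [hg.ae_hasDerivAt_integral, hne0] with x hx hxT hxm
  have hxm' : x ∈ Ioo 0 T := by
    rw [uIoc_of_le ht.2] at hxm
    exact ⟨ht.1.trans_lt hxm.1, lt_of_le_of_ne hxm.2 hxT⟩
  have h1 := hx (by rw [huIcc]; exact Ioo_subset_Icc_self hxm') 0 (by simp)
  have hcd : HasDerivAt c (g x) x := by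
    refine (h1.const_add (c 0)).congr_of_eventuallyEq ?_
    filter_upwards [isOpen_Ioo.mem_nhds hxm'] with y hy
    rw [← hc y (Ioo_subset_Icc_self hy)]
    abel
  have h2 := B.hasFDerivAt_of_bilinear hcd.hasFDerivAt hcd.hasFDerivAt
  have h3 := h2.hasDerivAt.deriv
  rw [h3]
  simp
  rw [hB]
  ring

/-! ### Poincaré inequality and inversion of the Laplacian -/

lemma tsupport_testFunction_subset {d : ℕ} {Ω : Opens (EuclideanSpace ℝ (Fin d))} (φ : 𝓓(Ω, ℝ)) :
    tsupport (φ : EuclideanSpace ℝ (Fin d) → ℝ) ⊆ Ω := φ.tsupport_subset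

lemma norm_gradient_eq {d : ℕ} (f : EuclideanSpace ℝ (Fin d) → ℝ) (x : EuclideanSpace ℝ (Fin d)) :
    ‖∇ f x‖ = ‖fderiv ℝ f x‖ := by
  rw [gradient, LinearIsometryEquiv.norm_map]

lemma continuous_gradient_testFunction {d : ℕ} {Ω : Opens (EuclideanSpace ℝ (Fin d))}
    (φ : 𝓓(Ω, ℝ)) : Continuous (∇ (φ : EuclideanSpace ℝ (Fin d) → ℝ)) := by
  have h := φ.contDiff.continuous_fderiv (by simp)
  exact (LinearIsometryEquiv.continuous _).comp h

lemma hasCompactSupport_gradient_testFunction {d : ℕ} {Ω : Opens (EuclideanSpace ℝ (Fin d))}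
    (φ : 𝓓(Ω, ℝ)) : HasCompactSupport (∇ (φ : EuclideanSpace ℝ (Fin d) → ℝ)) :=
  (φ.hasCompactSupport.fderiv ℝ).comp_left (map_zero _)

/-- The Poincaré inequality for test functions; it is the integration by parts of `φ²` against a
linear coordinate, which has derivative one and is bounded by `R` on `Ω`. -/
lemma integral_sq_le_of_testFunction {d : ℕ} (hd : 1 ≤ d) {Ω : Opens (EuclideanSpace ℝ (Fin d))}
    {R : ℝ} (hR : ∀ x ∈ Ω, ‖x‖ ≤ R) (φ : 𝓓(Ω, ℝ)) :
    ∫ x in Ω, φ x ^ 2 ≤ 4 * R ^ 2 * ∫ x in Ω, ‖∇ (φ : EuclideanSpace ℝ (Fin d) → ℝ) x‖ ^ 2 := by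
  let e : EuclideanSpace ℝ (Fin d) := EuclideanSpace.single ⟨0, hd⟩ 1
  have he : ‖e‖ = 1 := by simp [e]
  have hφd := differentiable_testFunction φ
  have hφc : HasCompactSupport (φ : EuclideanSpace ℝ (Fin d) → ℝ) := φ.hasCompactSupport
  have hφcont : Continuous (φ : EuclideanSpace ℝ (Fin d) → ℝ) := φ.continuous
  have hgc := continuous_gradient_testFunction φ
  have hgs := hasCompactSupport_gradient_testFunction φ
  let g : EuclideanSpace ℝ (Fin d) → ℝ := fun x => innerSL ℝ e x
  have hgd : ∀ x, fderiv ℝ g x = innerSL ℝ e := fun x => (innerSL ℝ e).fderiv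
  have hgcont : Continuous g := (innerSL ℝ e).continuous
  let f : EuclideanSpace ℝ (Fin d) → ℝ := fun x => φ x * φ x
  have hfd : ∀ x, fderiv ℝ f x e =
      2 * φ x * inner ℝ (∇ (φ : EuclideanSpace ℝ (Fin d) → ℝ) x) e := by
    intro x
    rw [inner_gradient_left, fderiv_fun_mul (hφd x) (hφd x)]
    simp
    ring
  have hintf : Integrable (fun x => f x * fderiv ℝ g x e) := by
    simp only [hgd]
    exact ((hφcont.mul hφcont).mul continuous_const).integrable_of_hasCompactSupport
      (hφc.mul_left.mul_right)
  have hintfg : Integrable (fun x => f x * g x) :=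
    ((hφcont.mul hφcont).mul hgcont).integrable_of_hasCompactSupport (hφc.mul_left.mul_right)
  have hintf'g : Integrable (fun x => fderiv ℝ f x e * g x) := by
    simp only [hfd]
    exact (((continuous_const.mul hφcont).mul (hgc.inner continuous_const)).mul
      hgcont).integrable_of_hasCompactSupport
        ((hφc.mul_left (f := fun _ => (2 : ℝ))).mul_right.mul_right)
  have hibp := integral_mul_fderiv_eq_neg_fderiv_mul_of_integrable hintf'g hintf hintfg
    (fun x _ => (hφd x).mul (hφd x)) (fun x _ => (innerSL ℝ e).differentiableAt)
  have hint1 : Integrable (fun x => φ x ^ 2) := by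
    simp only [pow_two]
    exact (hφcont.mul hφcont).integrable_of_hasCompactSupport hφc.mul_left
  have hint2 : Integrable (fun x => ‖∇ (φ : EuclideanSpace ℝ (Fin d) → ℝ) x‖ ^ 2) := by
    simp only [pow_two]
    exact (hgc.norm.mul hgc.norm).integrable_of_hasCompactSupport hgs.norm.mul_left
  have hzero : ∀ x, x ∉ (Ω : Set (EuclideanSpace ℝ (Fin d))) → φ x = 0 := fun x hx =>
    image_eq_zero_of_notMem_tsupport fun h => hx (tsupport_testFunction_subset φ h)
  have hzero' : ∀ x, x ∉ (Ω : Set (EuclideanSpace ℝ (Fin d))) →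
      ∇ (φ : EuclideanSpace ℝ (Fin d) → ℝ) x = 0 := fun x hx => by
    have : fderiv ℝ (φ : EuclideanSpace ℝ (Fin d) → ℝ) x = 0 :=
      image_eq_zero_of_notMem_tsupport fun h =>
        hx (tsupport_testFunction_subset φ (tsupport_fderiv_subset ℝ h))
    rw [gradient, this, map_zero]
  rw [setIntegral_eq_integral_of_forall_compl_eq_zero fun x hx => by rw [hzero x hx]; simp,
    setIntegral_eq_integral_of_forall_compl_eq_zero fun x hx => by rw [hzero' x hx]; simp]
  have h1 : ∫ x, φ x ^ 2 = -∫ x, fderiv ℝ f x e * g x := by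
    rw [← hibp]
    refine integral_congr_ae (Eventually.of_forall fun x => ?_)
    simp [hgd, f, he, pow_two]
  have h2 : -∫ x, fderiv ℝ f x e * g x ≤
      ∫ x, (1 / 2 * φ x ^ 2 + 2 * R ^ 2 * ‖∇ (φ : EuclideanSpace ℝ (Fin d) → ℝ) x‖ ^ 2) := by
    rw [← integral_neg]
    refine integral_mono hintf'g.neg ((hint1.const_mul _).add (hint2.const_mul _)) fun x => ?_
    by_cases hx : x ∈ (Ω : Set (EuclideanSpace ℝ (Fin d)))
    · have hg : |g x| ≤ R := by
        have := abs_real_inner_le_norm e x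
        rw [he, one_mul] at this
        exact this.trans (hR x hx)
      have hi : |inner ℝ (∇ (φ : EuclideanSpace ℝ (Fin d) → ℝ) x) e| ≤
          ‖∇ (φ : EuclideanSpace ℝ (Fin d) → ℝ) x‖ := by
        simpa [he] using abs_real_inner_le_norm (∇ (φ : EuclideanSpace ℝ (Fin d) → ℝ) x) e
      simp only [hfd]
      set i := inner ℝ (∇ (φ : EuclideanSpace ℝ (Fin d) → ℝ) x) e
      set N := ‖∇ (φ : EuclideanSpace ℝ (Fin d) → ℝ) x‖
      have h3 : |i * g x| ≤ N * R := by
        rw [abs_mul]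
        exact mul_le_mul hi hg (abs_nonneg _) (norm_nonneg _)
      have h4 : (i * g x) ^ 2 ≤ (N * R) ^ 2 := sq_le_sq' (by linarith [neg_abs_le (i * g x)])
        ((le_abs_self _).trans h3)
      -- Young's inequality, weighted so as to absorb half of `φ²` on the left.
      nlinarith [sq_nonneg (φ x + 2 * (i * g x))]
    · simp only [hfd]
      rw [hzero x hx]
      simp
      positivity
  rw [integral_add (hint1.const_mul _) (hint2.const_mul _), integral_const_mul,
    integral_const_mul] at h2
  linarith

lemma norm_sq_eq_integral {α E : Type*} [MeasurableSpace α] {μ : Measure α} [NormedAddCommGroup E]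
    [InnerProductSpace ℝ E] (f : Lp E 2 μ) : ‖f‖ ^ 2 = ∫ x, ‖f x‖ ^ 2 ∂μ := by
  rw [← real_inner_self_eq_norm_sq, L2.inner_def]
  simp

lemma norm_H01_sq {d : ℕ} {Ω : Opens (EuclideanSpace ℝ (Fin d))} (u : H01 Ω) :
    ‖u‖ ^ 2 = ‖H01.fn u‖ ^ 2 + ‖gradL Ω u‖ ^ 2 :=
  WithLp.prod_norm_sq_eq_of_L2 (u : SobolevPair Ω)

lemma norm_gradL_le {d : ℕ} {Ω : Opens (EuclideanSpace ℝ (Fin d))} (u : H01 Ω) :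
    ‖gradL Ω u‖ ≤ ‖u‖ := by
  refine le_of_sq_le_sq ?_ (norm_nonneg _)
  nlinarith [norm_H01_sq u, sq_nonneg ‖H01.fn u‖]

/-- **Poincaré inequality** on `H_0^1(Ω)`. -/
lemma norm_fn_sq_le {d : ℕ} (hd : 1 ≤ d) {Ω : Opens (EuclideanSpace ℝ (Fin d))}
    {R : ℝ} (hR : ∀ x ∈ Ω, ‖x‖ ≤ R) (u : H01 Ω) :
    ‖H01.fn u‖ ^ 2 ≤ 4 * R ^ 2 * ‖gradL Ω u‖ ^ 2 := by
  have hcl : IsClosed {p : SobolevPair Ω | ‖p.fst‖ ^ 2 ≤ 4 * R ^ 2 * ‖p.snd‖ ^ 2} := by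
    refine isClosed_le ?_ ?_
    · exact ((WithLp.fstL 2 ℝ _ _).continuous.norm).pow 2
    · exact (((WithLp.sndL 2 ℝ _ _).continuous.norm).pow 2).const_mul _
  refine closure_minimal (s := (testPairs Ω : Set (SobolevPair Ω))) ?_ hcl u.2
  rintro p ⟨φ, h1, h2⟩
  have e1 : ‖p.fst‖ ^ 2 = ∫ x in Ω, φ x ^ 2 := by
    rw [norm_sq_eq_integral]
    refine integral_congr_ae ?_
    filter_upwards [h1] with x hx
    rw [hx, Real.norm_eq_abs, sq_abs]
  have e2 : ‖p.snd‖ ^ 2 = ∫ x in Ω, ‖∇ (φ : EuclideanSpace ℝ (Fin d) → ℝ) x‖ ^ 2 := by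
    rw [norm_sq_eq_integral]
    refine integral_congr_ae ?_
    filter_upwards [h2] with x hx
    rw [hx]
  rw [mem_ofPred_eq, e1, e2]
  exact integral_sq_le_of_testFunction hd hR φ

/-- The Dirichlet form `(u, v) ↦ ∫_Ω ∇u · ∇v`. -/
def dirichletForm {d : ℕ} (Ω : Opens (EuclideanSpace ℝ (Fin d))) :
    H01 Ω →L[ℝ] H01 Ω →L[ℝ] ℝ :=
  LinearMap.mkContinuous₂
    (LinearMap.mk₂ ℝ (fun u v => inner ℝ (gradL Ω u) (gradL Ω v))
      (fun u v w => by rw [map_add, inner_add_left])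
      (fun c u v => by rw [map_smul, real_inner_smul_left, smul_eq_mul])
      (fun u v w => by rw [map_add, inner_add_right])
      (fun c u v => by rw [map_smul, real_inner_smul_right, smul_eq_mul])) 1
    fun u v => by
      rw [LinearMap.mk₂_apply, one_mul]
      exact (norm_inner_le_norm _ _).trans
        (mul_le_mul (norm_gradL_le u) (norm_gradL_le v) (norm_nonneg _) (norm_nonneg _))

lemma dirichletForm_apply {d : ℕ} {Ω : Opens (EuclideanSpace ℝ (Fin d))} (u v : H01 Ω) :
    dirichletForm Ω u v = inner ℝ (gradL Ω u) (gradL Ω v) := rfl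

/-- On a bounded domain the Laplacian `H_0^1(Ω) → H^{-1}(Ω)` has a bounded inverse; `G` is the
inverse of `-Δ`. -/
lemma exists_inverse_laplacian {d : ℕ} (hd : 1 ≤ d) {Ω : Opens (EuclideanSpace ℝ (Fin d))}
    (hΩ : Bornology.IsBounded (Ω : Set (EuclideanSpace ℝ (Fin d)))) :
    ∃ G : Hneg Ω →L[ℝ] H01 Ω, ∀ (p : Hneg Ω) (v : H01 Ω),
      inner ℝ (gradL Ω (G p)) (gradL Ω v) = p v := by
  obtain ⟨R, hR⟩ := hΩ.exists_norm_le
  have hco : IsCoercive (dirichletForm Ω) := by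
    refine ⟨(1 + 4 * R ^ 2)⁻¹, by positivity, fun u => ?_⟩
    rw [dirichletForm_apply, real_inner_self_eq_norm_sq, mul_assoc, inv_mul_le_iff₀ (by positivity),
      ← pow_two]
    linarith [norm_fn_sq_le hd hR u, norm_H01_sq u]
  let E := hco.continuousLinearEquivOfBilin
  let L : Hneg Ω →ₗ[ℝ] H01 Ω :=
    { toFun := fun p => E.symm ((InnerProductSpace.toDual ℝ (H01 Ω)).symm p)
      map_add' := fun p r => by simp only [map_add]
      map_smul' := fun c p => by simp }
  have hL : Continuous L := by
    have h1 : Continuous (InnerProductSpace.toDual ℝ (H01 Ω)).symm :=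
      (InnerProductSpace.toDual ℝ (H01 Ω)).symm.continuous
    exact E.symm.continuous.comp h1
  refine ⟨⟨L, hL⟩, fun p v => ?_⟩
  rw [← dirichletForm_apply, ← hco.continuousLinearEquivOfBilin_apply]
  change inner ℝ (E (E.symm ((InnerProductSpace.toDual ℝ (H01 Ω)).symm p))) v = p v
  rw [ContinuousLinearEquiv.apply_symm_apply, InnerProductSpace.toDual_symm_apply]

/-! ### Superposition operators on `L²` -/

section Superposition

variable {α F F' : Type*} [MeasurableSpace α] {μ : Measure α} [NormedAddCommGroup F]
  [NormedAddCommGroup F']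

lemma unifIntegrable_of_norm_le {f : ℕ → α → F} {h : ℕ → α → F'} (hh : UnifIntegrable h 2 μ)
    (hfh : ∀ n, ∀ᵐ x ∂μ, ‖f n x‖ ≤ ‖h n x‖) : UnifIntegrable f 2 μ := by
  intro ε hε
  obtain ⟨δ, hδ, H⟩ := hh hε
  refine ⟨δ, hδ, fun i s hs hμ => (eLpNorm_mono_ae ?_).trans (H i s hs hμ)⟩
  filter_upwards [hfh i] with x hx
  by_cases hxs : x ∈ s <;> simp [hxs, hx]

/-- Dominated convergence in `L²`. -/
lemma tendsto_eLpNorm_of_dominated [IsFiniteMeasure μ] {f : ℕ → α → F} {g : α → F} {h : α → F'}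
    (hf : ∀ n, AEStronglyMeasurable (f n) μ) (hg : MemLp g 2 μ) (hh : MemLp h 2 μ)
    (hfh : ∀ n, ∀ᵐ x ∂μ, ‖f n x‖ ≤ ‖h x‖)
    (hfg : ∀ᵐ x ∂μ, Tendsto (fun n => f n x) atTop (𝓝 (g x))) :
    Tendsto (fun n => eLpNorm (f n - g) 2 μ) atTop (𝓝 0) :=
  tendsto_Lp_finite_of_tendsto_ae (by norm_num) (by norm_num) hf hg
    (unifIntegrable_of_norm_le (unifIntegrable_const (by norm_num) (by norm_num) hh) hfh) hfg

/-- Sequential continuity on `L²` of the superposition operator `f ↦ N(·, f(·))` of a function `N`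
that is continuous and of linear growth in its second argument; Vitali's theorem is applied along
almost everywhere convergent subsequences. -/
lemma tendsto_eLpNorm_superposition [NormedSpace ℝ F] [IsFiniteMeasure μ] {L : ℝ} {N : α → F → F'}
    {f : ℕ → α → F} {g : α → F} (hf : ∀ n, MemLp (f n) 2 μ) (hg : MemLp g 2 μ)
    (hfg : Tendsto (fun n => eLpNorm (f n - g) 2 μ) atTop (𝓝 0))
    (hN : ∀ᵐ x ∂μ, Continuous (N x)) (hL : ∀ᵐ x ∂μ, ∀ y, ‖N x y‖ ≤ L * ‖y‖)
    (hNf : ∀ n, AEStronglyMeasurable (fun x => N x (f n x)) μ)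
    (hNg : AEStronglyMeasurable (fun x => N x (g x)) μ) :
    Tendsto (fun n => eLpNorm ((fun x => N x (f n x)) - fun x => N x (g x)) 2 μ) atTop (𝓝 0) := by
  refine tendsto_of_subseq_tendsto fun ns hns => ?_
  have h1 : Tendsto (fun n => eLpNorm (f (ns n) - g) 2 μ) atTop (𝓝 0) := hfg.comp hns
  obtain ⟨ms, hms, hae⟩ := (tendstoInMeasure_of_tendsto_eLpNorm (by norm_num)
    (fun n => (hf (ns n)).1) hg.1 h1).exists_seq_tendsto_ae
  refine ⟨ms, ?_⟩
  have h2 : Tendsto (fun n => eLpNorm (L • f (ns (ms n)) - L • g) 2 μ) atTop (𝓝 0) := by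
    simp_rw [← smul_sub, eLpNorm_const_smul]
    have := ENNReal.Tendsto.const_mul (a := ‖L‖ₑ) (h1.comp hms.tendsto_atTop)
      (Or.inr (by simp))
    simpa using this
  have h3 := unifIntegrable_of_tendsto_Lp (by norm_num) (by norm_num)
    (fun n => (hf (ns (ms n))).const_smul L) (hg.const_smul L) h2
  have hmem : MemLp (fun x => N x (g x)) 2 μ :=
    hg.of_le_mul hNg (hL.mono fun x hx => hx _)
  refine tendsto_Lp_finite_of_tendsto_ae (by norm_num) (by norm_num)
    (fun n => hNf (ns (ms n))) hmem (unifIntegrable_of_norm_le h3 fun n => ?_) ?_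
  · filter_upwards [hL] with x hx
    refine (hx _).trans ?_
    rw [Pi.smul_apply, norm_smul]
    gcongr
    exact Real.le_norm_self L
  · filter_upwards [hae, hN] with x hx hx'
    exact (hx'.tendsto _).comp hx

lemma tendsto_eLpNorm_prodMk {f : ℕ → Lp F 2 μ} {f₀ : Lp F 2 μ} {g : ℕ → Lp F' 2 μ}
    {g₀ : Lp F' 2 μ} (hf : Tendsto f atTop (𝓝 f₀)) (hg : Tendsto g atTop (𝓝 g₀)) :
    Tendsto (fun n => eLpNorm ((fun x => (f n x, g n x)) - fun x => (f₀ x, g₀ x)) 2 μ)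
      atTop (𝓝 0) := by
  have hsum := ((Lp.tendsto_Lp_iff_tendsto_eLpNorm' _ _).1 hf).add
    ((Lp.tendsto_Lp_iff_tendsto_eLpNorm' _ _).1 hg)
  rw [add_zero] at hsum
  refine tendsto_of_tendsto_of_tendsto_of_le_of_le tendsto_const_nhds hsum
    (fun n => zero_le) fun n => ?_
  simp only
  rw [← eLpNorm_norm (⇑(f n) - ⇑f₀), ← eLpNorm_norm (⇑(g n) - ⇑g₀)]
  refine le_trans ?_ (eLpNorm_add_le
    ((Lp.aestronglyMeasurable (f n)).sub (Lp.aestronglyMeasurable f₀)).norm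
    ((Lp.aestronglyMeasurable (g n)).sub (Lp.aestronglyMeasurable g₀)).norm (by norm_num))
  refine eLpNorm_mono fun x => ?_
  simp only [Pi.sub_apply, Pi.add_apply, Prod.mk_sub_mk, Prod.norm_mk]
  rw [Real.norm_of_nonneg (by positivity)]
  exact max_le (le_add_of_nonneg_right (norm_nonneg _)) (le_add_of_nonneg_left (norm_nonneg _))

end Superposition

/-! ### The chain rule in `H_0^1(Ω)` -/

/-- A bounded continuous function `ψ` and a bounded continuous vector field `Ψ`; in the applications
`Ψ` is the gradient of `ψ`. -/
structure IsMultiplier {d : ℕ} (ψ : EuclideanSpace ℝ (Fin d) → ℝ)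
    (Ψ : EuclideanSpace ℝ (Fin d) → EuclideanSpace ℝ (Fin d)) : Prop where
  continuous_fst : Continuous ψ
  continuous_snd : Continuous Ψ
  bounded : ∃ C, ∀ x, ‖ψ x‖ ≤ C ∧ ‖Ψ x‖ ≤ C

lemma isMultiplier_testFunction {d : ℕ} {Ω : Opens (EuclideanSpace ℝ (Fin d))} (ψ : 𝓓(Ω, ℝ)) :
    IsMultiplier ψ (∇ (ψ : EuclideanSpace ℝ (Fin d) → ℝ)) := by
  refine ⟨ψ.continuous, continuous_gradient_testFunction ψ, ?_⟩
  obtain ⟨C, hC⟩ := ψ.hasCompactSupport.exists_bound_of_continuous ψ.continuous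
  obtain ⟨C', hC'⟩ := (hasCompactSupport_gradient_testFunction ψ).exists_bound_of_continuous
    (continuous_gradient_testFunction ψ)
  exact ⟨max C C', fun x => ⟨(hC x).trans (le_max_left _ _), (hC' x).trans (le_max_right _ _)⟩⟩

/-- A pair `(g, h)` of growth `|g v| ≤ |v|`, `|h v| ≤ 1`; in the applications `h` is the
derivative of `g`, possibly off `0` only. -/
structure IsNemytskiiPair (g h : ℝ → ℝ) : Prop where
  measurable_fst : Measurable g
  measurable_snd : Measurable h
  abs_fst_le : ∀ v, |g v| ≤ |v|
  abs_snd_le : ∀ v, |h v| ≤ 1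

section ModPair

variable {d : ℕ} {Ω : Opens (EuclideanSpace ℝ (Fin d))} {g h : ℝ → ℝ}
  {ψ : EuclideanSpace ℝ (Fin d) → ℝ} {Ψ : EuclideanSpace ℝ (Fin d) → EuclideanSpace ℝ (Fin d)}

lemma IsNemytskiiPair.memLp_fst (H : IsNemytskiiPair g h) (M : IsMultiplier ψ Ψ)
    (p : SobolevPair Ω) :
    MemLp (fun x => ψ x * g (p.fst x)) 2 (spaceMeasure Ω) := by
  obtain ⟨C, hC⟩ := M.bounded
  refine (Lp.memLp p.fst).of_le_mul (c := C) ?_ (Eventually.of_forall fun x => ?_)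
  · exact M.continuous_fst.aestronglyMeasurable.mul
      (H.measurable_fst.comp_aemeasurable
        (Lp.aestronglyMeasurable p.fst).aemeasurable).aestronglyMeasurable
  · rw [norm_mul]
    exact mul_le_mul (hC x).1 (H.abs_fst_le _) (norm_nonneg _) ((norm_nonneg _).trans (hC x).1)

lemma IsNemytskiiPair.norm_snd_le (H : IsNemytskiiPair g h) {C : ℝ}
    {x : EuclideanSpace ℝ (Fin d)}
    (hC : ‖ψ x‖ ≤ C ∧ ‖Ψ x‖ ≤ C) (v : ℝ)
    (G : EuclideanSpace ℝ (Fin d)) :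
    ‖g v • Ψ x + (ψ x * h v) • G‖ ≤ C * ‖v‖ + C * ‖G‖ := by
  refine (norm_add_le _ _).trans (add_le_add ?_ ?_)
  · rw [norm_smul, mul_comm]
    exact mul_le_mul hC.2 (H.abs_fst_le _) (norm_nonneg _) ((norm_nonneg _).trans hC.1)
  · rw [norm_smul, norm_mul]
    refine mul_le_mul_of_nonneg_right ?_ (norm_nonneg _)
    calc ‖ψ x‖ * ‖h v‖ ≤ C * 1 :=
          mul_le_mul hC.1 (H.abs_snd_le _) (norm_nonneg _) ((norm_nonneg _).trans hC.1)
      _ = C := mul_one C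

lemma IsNemytskiiPair.aestronglyMeasurable_snd (H : IsNemytskiiPair g h) (M : IsMultiplier ψ Ψ)
    (p : SobolevPair Ω) : AEStronglyMeasurable (fun x =>
      g (p.fst x) • Ψ x + (ψ x * h (p.fst x)) • p.snd x)
      (spaceMeasure Ω) := by
  have hm := (Lp.aestronglyMeasurable p.fst).aemeasurable
  exact ((H.measurable_fst.comp_aemeasurable hm).aestronglyMeasurable.smul
    M.continuous_snd.aestronglyMeasurable).add
    ((M.continuous_fst.aestronglyMeasurable.mul
      (H.measurable_snd.comp_aemeasurable hm).aestronglyMeasurable).smul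
      (Lp.aestronglyMeasurable p.snd))

lemma IsNemytskiiPair.memLp_snd (H : IsNemytskiiPair g h) (M : IsMultiplier ψ Ψ)
    (p : SobolevPair Ω) :
    MemLp (fun x =>
      g (p.fst x) • Ψ x + (ψ x * h (p.fst x)) • p.snd x) 2
      (spaceMeasure Ω) := by
  obtain ⟨C, hC⟩ := M.bounded
  have hC0 : 0 ≤ C := (norm_nonneg _).trans (hC 0).1
  have hsum : MemLp (fun x => C * ‖p.fst x‖ + C * ‖p.snd x‖) 2 (spaceMeasure Ω) :=
    ((Lp.memLp p.fst).norm.const_mul C).add ((Lp.memLp p.snd).norm.const_mul C)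
  refine hsum.mono (H.aestronglyMeasurable_snd M p) (Eventually.of_forall fun x => ?_)
  exact (H.norm_snd_le (hC x) _ _).trans (Real.le_norm_self _)

/-- The pair `(ψ g(u), g(u) Ψ + ψ h(u) G)` built from `p = (u, G)`; for `Ψ = ∇ψ`, `G = ∇u` and
`h = g'` this is the function `ψ g(u)` together with its gradient. -/
def modPair (H : IsNemytskiiPair g h) (M : IsMultiplier ψ Ψ) (p : SobolevPair Ω) : SobolevPair Ω :=
  WithLp.toLp 2 ((H.memLp_fst M p).toLp _, (H.memLp_snd M p).toLp _)

lemma modPair_fst (H : IsNemytskiiPair g h) (M : IsMultiplier ψ Ψ) (p : SobolevPair Ω) :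
    (modPair H M p).fst =ᵐ[spaceMeasure Ω] fun x => ψ x * g (p.fst x) :=
  (H.memLp_fst M p).coeFn_toLp

lemma modPair_snd (H : IsNemytskiiPair g h) (M : IsMultiplier ψ Ψ) (p : SobolevPair Ω) :
    (modPair H M p).snd =ᵐ[spaceMeasure Ω] fun x =>
      g (p.fst x) • Ψ x + (ψ x * h (p.fst x)) • p.snd x :=
  (H.memLp_snd M p).coeFn_toLp

lemma norm_sobolevPair_le (p : SobolevPair Ω) : ‖p‖ ≤ ‖p.fst‖ + ‖p.snd‖ := by
  refine le_of_sq_le_sq ?_ (by positivity)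
  rw [WithLp.prod_norm_sq_eq_of_L2]
  nlinarith [norm_nonneg p.fst, norm_nonneg p.snd]

lemma norm_fst_sobolevPair_le (p : SobolevPair Ω) : ‖p.fst‖ ≤ ‖p‖ := by
  refine le_of_sq_le_sq ?_ (norm_nonneg _)
  rw [WithLp.prod_norm_sq_eq_of_L2]
  nlinarith [sq_nonneg ‖p.snd‖]

lemma norm_snd_sobolevPair_le (p : SobolevPair Ω) : ‖p.snd‖ ≤ ‖p‖ := by
  refine le_of_sq_le_sq ?_ (norm_nonneg _)
  rw [WithLp.prod_norm_sq_eq_of_L2]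
  nlinarith [sq_nonneg ‖p.fst‖]

lemma norm_modPair_le (H : IsNemytskiiPair g h) (M : IsMultiplier ψ Ψ) {C : ℝ}
    (hC : ∀ x, ‖ψ x‖ ≤ C ∧ ‖Ψ x‖ ≤ C) (p : SobolevPair Ω) :
    ‖modPair H M p‖ ≤ 3 * C * ‖p‖ := by
  have hC0 : 0 ≤ C := (norm_nonneg _).trans (hC 0).1
  have h1 : ‖(modPair H M p).fst‖ ≤ C * ‖p.fst‖ := by
    refine Lp.norm_le_mul_norm_of_ae_le_mul ?_
    filter_upwards [modPair_fst H M p] with x hx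
    rw [hx, norm_mul]
    exact mul_le_mul (hC x).1 (H.abs_fst_le _) (norm_nonneg _) hC0
  have h2 : ‖(modPair H M p).snd‖ ≤ C * ‖p.fst‖ + C * ‖p.snd‖ := by
    have h3 : MemLp (fun x => C * ‖p.fst x‖) 2 (spaceMeasure Ω) :=
      (Lp.memLp p.fst).norm.const_mul C
    have h4 : MemLp (fun x => C * ‖p.snd x‖) 2 (spaceMeasure Ω) :=
      (Lp.memLp p.snd).norm.const_mul C
    have h5 : ‖h3.toLp _‖ ≤ C * ‖p.fst‖ := by
      refine Lp.norm_le_mul_norm_of_ae_le_mul ?_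
      filter_upwards [h3.coeFn_toLp] with x hx
      rw [hx, norm_mul, norm_norm, Real.norm_of_nonneg hC0]
    have h6 : ‖h4.toLp _‖ ≤ C * ‖p.snd‖ := by
      refine Lp.norm_le_mul_norm_of_ae_le_mul ?_
      filter_upwards [h4.coeFn_toLp] with x hx
      rw [hx, norm_mul, norm_norm, Real.norm_of_nonneg hC0]
    refine le_trans ?_ ((norm_add_le (h3.toLp _) (h4.toLp _)).trans (add_le_add h5 h6))
    refine Lp.norm_le_norm_of_ae_le ?_
    filter_upwards [modPair_snd H M p, h3.coeFn_toLp, h4.coeFn_toLp,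
      Lp.coeFn_add (h3.toLp _) (h4.toLp _)] with x h7 h8 h9 h10
    rw [h7, h10, Pi.add_apply, h8, h9]
    exact (H.norm_snd_le (hC x) _ _).trans (Real.le_norm_self _)
  have h3 := norm_sobolevPair_le (modPair H M p)
  have h4 := mul_le_mul_of_nonneg_left (norm_fst_sobolevPair_le p) hC0
  have h5 := mul_le_mul_of_nonneg_left (norm_snd_sobolevPair_le p) hC0
  linarith

lemma tendsto_modPair_of_eLpNorm {g' h' : ℕ → ℝ → ℝ} (H' : ∀ n, IsNemytskiiPair (g' n) (h' n))
    (H : IsNemytskiiPair g h) (M : IsMultiplier ψ Ψ) {p : ℕ → SobolevPair Ω} {p₀ : SobolevPair Ω}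
    (h1 : Tendsto (fun n => eLpNorm ((fun x => ψ x * g' n ((p n).fst x)) -
      fun x => ψ x * g (p₀.fst x)) 2 (spaceMeasure Ω)) atTop (𝓝 0))
    (h2 : Tendsto (fun n => eLpNorm ((fun x =>
        g' n ((p n).fst x) • Ψ x +
          (ψ x * h' n ((p n).fst x)) • (p n).snd x) -
      fun x => g (p₀.fst x) • Ψ x +
          (ψ x * h (p₀.fst x)) • p₀.snd x) 2 (spaceMeasure Ω)) atTop (𝓝 0)) :
    Tendsto (fun n => modPair (H' n) M (p n)) atTop (𝓝 (modPair H M p₀)) := by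
  refine ((WithLp.prod_continuous_toLp 2 _ _).tendsto _).comp (Tendsto.prodMk_nhds ?_ ?_)
  · exact (Lp.tendsto_Lp_iff_tendsto_eLpNorm'' _ (fun n => (H' n).memLp_fst M (p n)) _ _).2 h1
  · exact (Lp.tendsto_Lp_iff_tendsto_eLpNorm'' _ (fun n => (H' n).memLp_snd M (p n)) _ _).2 h2

lemma memLp_prodMk (p : SobolevPair Ω) :
    MemLp (fun x => (p.fst x, p.snd x)) 2 (spaceMeasure Ω) :=
  MemLp.of_fst_snd ⟨Lp.memLp p.fst, Lp.memLp p.snd⟩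

lemma continuous_modPair (hΩ : Bornology.IsBounded (Ω : Set (EuclideanSpace ℝ (Fin d))))
    (H : IsNemytskiiPair g h) (M : IsMultiplier ψ Ψ) (hg : Continuous g) (hh : Continuous h) :
    Continuous (modPair (Ω := Ω) H M) := by
  have : IsFiniteMeasure (spaceMeasure Ω) := ⟨by simpa using hΩ.measure_lt_top⟩
  obtain ⟨C, hC⟩ := M.bounded
  have hC0 : 0 ≤ C := (norm_nonneg _).trans (hC 0).1
  refine continuous_iff_seqContinuous.2 fun p p₀ hp => ?_
  have hfst := ((WithLp.fstL 2 ℝ _ _).continuous.tendsto p₀).comp hp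
  have hsnd := ((WithLp.sndL 2 ℝ _ _).continuous.tendsto p₀).comp hp
  have hpair := tendsto_eLpNorm_prodMk hfst hsnd
  refine tendsto_modPair_of_eLpNorm (fun _ => H) H M ?_ ?_
  · refine tendsto_eLpNorm_superposition (L := C) (N := fun x y => ψ x * g y)
      (fun n => Lp.memLp (p n).fst) (Lp.memLp p₀.fst)
      ((Lp.tendsto_Lp_iff_tendsto_eLpNorm' _ _).1 hfst)
      (Eventually.of_forall fun x => continuous_const.mul hg)
      (Eventually.of_forall fun x y => ?_) (fun n => (H.memLp_fst M (p n)).1)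
      (H.memLp_fst M p₀).1
    rw [norm_mul]
    exact mul_le_mul (hC x).1 (H.abs_fst_le _) (norm_nonneg _) hC0
  · refine tendsto_eLpNorm_superposition (L := 2 * C)
      (N := fun x (y : ℝ × EuclideanSpace ℝ (Fin d)) =>
        g y.1 • Ψ x + (ψ x * h y.1) • y.2)
      (f := fun n x => ((p n).fst x, (p n).snd x)) (g := fun x => (p₀.fst x, p₀.snd x))
      (fun n => memLp_prodMk (p n)) (memLp_prodMk p₀) hpair
      (Eventually.of_forall fun x => by fun_prop)
      (Eventually.of_forall fun x y => ?_) (fun n => H.aestronglyMeasurable_snd M (p n))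
      (H.aestronglyMeasurable_snd M p₀)
    refine (H.norm_snd_le (hC x) y.1 y.2).trans ?_
    have h1 := mul_le_mul_of_nonneg_left (norm_fst_le y) hC0
    have h2 := mul_le_mul_of_nonneg_left (norm_snd_le y) hC0
    linarith

/-- The chain rule: for smooth `g` and `u ∈ H_0^1(Ω)` the pair `(ψ g(u), ∇(ψ g(u)))` belongs to
`H_0^1(Ω)`, by density of the test functions. -/
lemma modPair_mem (hΩ : Bornology.IsBounded (Ω : Set (EuclideanSpace ℝ (Fin d))))
    (hg : ContDiff ℝ ∞ g) (H : IsNemytskiiPair g (deriv g)) (ψ : 𝓓(Ω, ℝ)) (u : H01 Ω) :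
    modPair H (isMultiplier_testFunction ψ) u ∈ (testPairs Ω).topologicalClosure := by
  have hcont := continuous_modPair hΩ H (isMultiplier_testFunction ψ) hg.continuous
    (hg.continuous_deriv (by simp))
  refine map_mem_closure hcont u.2 ?_
  rintro p ⟨φ, h1, h2⟩
  have hφd := differentiable_testFunction φ
  have hψd := differentiable_testFunction ψ
  let η : 𝓓(Ω, ℝ) := ⟨fun x => ψ x * g (φ x), ψ.contDiff.mul (hg.comp φ.contDiff),
    ψ.hasCompactSupport.mul_right, (tsupport_mul_subset_left).trans ψ.tsupport_subset⟩
  refine ⟨η, ?_, ?_⟩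
  · filter_upwards [modPair_fst H (isMultiplier_testFunction ψ) p, h1] with x h3 h4
    rw [h3, h4]
    rfl
  · filter_upwards [modPair_snd H (isMultiplier_testFunction ψ) p, h1, h2] with x h3 h4 h5
    rw [h3, h4, h5]
    have hgd := (hg.differentiable (by simp)) (φ x)
    have h6 : fderiv ℝ (fun x => ψ x * g (φ x)) x =
        g (φ x) • fderiv ℝ ψ x + (ψ x * deriv g (φ x)) • fderiv ℝ φ x := by
      have h7 : HasFDerivAt (fun x => g (φ x)) (deriv g (φ x) • fderiv ℝ φ x) x :=
        hgd.hasDerivAt.comp_hasFDerivAt x (hφd x).hasFDerivAt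
      have h8 := ((hψd x).hasFDerivAt.mul h7).fderiv
      refine h8.trans ?_
      rw [smul_smul, add_comm]
    change _ = ∇ (fun x => ψ x * g (φ x)) x
    simp only [gradient]
    rw [h6, map_add]
    simp

end ModPair

/-! ### Smooth approximation of the modulus -/

/-- The smooth approximation `√(v² + ε²) - ε` of `|v|`. -/
def smoothAbs (ε v : ℝ) : ℝ := √(v ^ 2 + ε ^ 2) - ε

lemma contDiff_smoothAbs {ε : ℝ} (hε : 0 < ε) : ContDiff ℝ ∞ (smoothAbs ε) := by
  have : ∀ v : ℝ, v ^ 2 + ε ^ 2 ≠ 0 := fun v => by positivity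
  exact ((by fun_prop : ContDiff ℝ ∞ fun v : ℝ => v ^ 2 + ε ^ 2).sqrt this).sub contDiff_const

lemma deriv_smoothAbs {ε : ℝ} (hε : 0 < ε) (v : ℝ) :
    deriv (smoothAbs ε) v = v / √(v ^ 2 + ε ^ 2) := by
  have h1 : HasDerivAt (fun v : ℝ => v ^ 2 + ε ^ 2) (2 * v) v := by
    simpa using (hasDerivAt_pow 2 v).add_const (ε ^ 2)
  have h2 := (h1.sqrt (by positivity)).sub_const ε
  refine h2.deriv.trans ?_
  field_simp

lemma abs_le_sqrt_add (ε v : ℝ) : |v| ≤ √(v ^ 2 + ε ^ 2) :=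
  Real.abs_le_sqrt (by nlinarith [sq_nonneg ε])

lemma isNemytskiiPair_smoothAbs {ε : ℝ} (hε : 0 < ε) :
    IsNemytskiiPair (smoothAbs ε) (deriv (smoothAbs ε)) where
  measurable_fst := (contDiff_smoothAbs hε).continuous.measurable
  measurable_snd := measurable_deriv _
  abs_fst_le v := by
    have h1 : ε ≤ √(v ^ 2 + ε ^ 2) := Real.le_sqrt_of_sq_le (by nlinarith [sq_nonneg v])
    have h2 : √(v ^ 2 + ε ^ 2) ≤ |v| + ε := by
      refine Real.sqrt_le_iff.2 ⟨by positivity, ?_⟩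
      nlinarith [sq_abs v, abs_nonneg v]
    rw [smoothAbs, abs_of_nonneg (by linarith)]
    linarith
  abs_snd_le v := by
    rw [deriv_smoothAbs hε, abs_div, abs_of_nonneg (Real.sqrt_nonneg _)]
    exact div_le_one_of_le₀ (abs_le_sqrt_add ε v) (Real.sqrt_nonneg _)

/-- At `0` the derivative of the modulus takes the value `0 / 0 = 0`, which is the limit of the
derivatives of the smooth approximations. -/
lemma isNemytskiiPair_abs : IsNemytskiiPair (fun v => |v|) (fun v => v / |v|) where
  measurable_fst := continuous_abs.measurable
  measurable_snd := measurable_id.div continuous_abs.measurable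
  abs_fst_le v := by simp
  abs_snd_le v := by
    rw [abs_div, abs_abs]
    exact div_self_le_one _

lemma tendsto_smoothAbs {ε : ℕ → ℝ} (hε : Tendsto ε atTop (𝓝 0)) (v : ℝ) :
    Tendsto (fun n => smoothAbs (ε n) v) atTop (𝓝 |v|) := by
  have h : Continuous fun e : ℝ => √(v ^ 2 + e ^ 2) - e := by fun_prop
  have := (h.tendsto 0).comp hε
  simpa [Real.sqrt_sq_eq_abs, Function.comp_def, smoothAbs] using this

lemma tendsto_deriv_smoothAbs {ε : ℕ → ℝ} (hpos : ∀ n, 0 < ε n) (hε : Tendsto ε atTop (𝓝 0))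
    (v : ℝ) : Tendsto (fun n => deriv (smoothAbs (ε n)) v) atTop (𝓝 (v / |v|)) := by
  simp only [deriv_smoothAbs (hpos _)]
  rcases eq_or_ne v 0 with rfl | hv
  · simp
  · have h : Continuous fun e : ℝ => √(v ^ 2 + e ^ 2) := by fun_prop
    have := (h.tendsto 0).comp hε
    refine tendsto_const_nhds.div ?_ (abs_ne_zero.2 hv)
    simpa [Real.sqrt_sq_eq_abs, Function.comp_def] using this

section Modulus

variable {d : ℕ} {Ω : Opens (EuclideanSpace ℝ (Fin d))}
  {ψ : EuclideanSpace ℝ (Fin d) → ℝ} {Ψ : EuclideanSpace ℝ (Fin d) → EuclideanSpace ℝ (Fin d)}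

lemma tendsto_modPair_smoothAbs (hΩ : Bornology.IsBounded (Ω : Set (EuclideanSpace ℝ (Fin d))))
    (M : IsMultiplier ψ Ψ) (p : SobolevPair Ω) {ε : ℕ → ℝ} (hpos : ∀ n, 0 < ε n)
    (hε : Tendsto ε atTop (𝓝 0)) :
    Tendsto (fun n => modPair (isNemytskiiPair_smoothAbs (hpos n)) M p) atTop
      (𝓝 (modPair isNemytskiiPair_abs M p)) := by
  have : IsFiniteMeasure (spaceMeasure Ω) := ⟨by simpa using hΩ.measure_lt_top⟩
  obtain ⟨C, hC⟩ := M.bounded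
  have hC0 : 0 ≤ C := (norm_nonneg _).trans (hC 0).1
  refine tendsto_modPair_of_eLpNorm (g' := fun n => smoothAbs (ε n))
    (h' := fun n => deriv (smoothAbs (ε n))) (p := fun _ => p)
    (fun n => isNemytskiiPair_smoothAbs (hpos n)) isNemytskiiPair_abs M ?_ ?_
  · refine tendsto_eLpNorm_of_dominated (h := fun x => C * p.fst x)
      (fun n => ((isNemytskiiPair_smoothAbs (hpos n)).memLp_fst M p).1)
      (isNemytskiiPair_abs.memLp_fst M p) ((Lp.memLp p.fst).const_mul C)
      (fun n => Eventually.of_forall fun x => ?_) (Eventually.of_forall fun x => ?_)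
    · rw [norm_mul, norm_mul, Real.norm_of_nonneg hC0]
      exact mul_le_mul (hC x).1 ((isNemytskiiPair_smoothAbs (hpos n)).abs_fst_le _)
        (norm_nonneg _) hC0
    · exact (tendsto_smoothAbs hε _).const_mul _
  · refine tendsto_eLpNorm_of_dominated (h := fun x => C * ‖p.fst x‖ + C * ‖p.snd x‖)
      (fun n => (isNemytskiiPair_smoothAbs (hpos n)).aestronglyMeasurable_snd M p)
      (isNemytskiiPair_abs.memLp_snd M p)
      (((Lp.memLp p.fst).norm.const_mul C).add ((Lp.memLp p.snd).norm.const_mul C))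
      (fun n => Eventually.of_forall fun x => ?_) (Eventually.of_forall fun x => ?_)
    · exact ((isNemytskiiPair_smoothAbs (hpos n)).norm_snd_le (hC x) _ _).trans
        (Real.le_norm_self _)
    · exact ((tendsto_smoothAbs hε _).smul_const _).add
        (((tendsto_deriv_smoothAbs hpos hε _).const_mul _).smul_const _)

/-- `ψ |u| ∈ H_0^1(Ω)`; the gradient obtained in the limit is `|u| ∇ψ + ψ sign(u) ∇u`. -/
lemma modPair_abs_mem (hΩ : Bornology.IsBounded (Ω : Set (EuclideanSpace ℝ (Fin d))))
    (ψ : 𝓓(Ω, ℝ)) (u : H01 Ω) :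
    modPair isNemytskiiPair_abs (isMultiplier_testFunction ψ) u ∈
      (testPairs Ω).topologicalClosure := by
  have hpos : ∀ n : ℕ, (0 : ℝ) < 1 / ((n : ℝ) + 1) := fun n => by positivity
  exact (testPairs Ω).isClosed_topologicalClosure.mem_of_tendsto
    (tendsto_modPair_smoothAbs hΩ (isMultiplier_testFunction ψ) (u : SobolevPair Ω) hpos
      tendsto_one_div_add_atTop_nhds_zero_nat)
    (Eventually.of_forall fun n => modPair_mem hΩ (contDiff_smoothAbs (hpos n))
      (isNemytskiiPair_smoothAbs (hpos n)) ψ u)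

end Modulus

/-! ### Measurability in time of products -/

section Measurability

/-- If `t ↦ m t x` is measurable for every `x` and each `m t` is bounded and continuous, then the
product of `m t` with a strongly measurable `L²`-valued map is strongly measurable: it is the limit
of the products with `m t ∘ π`, where `π` has finite range. -/
lemma aestronglyMeasurable_bilin {β α F₁ F₂ F₃ : Type*} [MeasurableSpace β] {ν : Measure β}
    [MeasurableSpace α] [PseudoEMetricSpace α] [OpensMeasurableSpace α] [SeparableSpace α]
    [Nonempty α] {μ : Measure α} [IsFiniteMeasure μ] [NormedAddCommGroup F₁] [NormedSpace ℝ F₁]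
    [NormedAddCommGroup F₂] [NormedSpace ℝ F₂] [NormedAddCommGroup F₃] [NormedSpace ℝ F₃]
    (B : F₁ →L[ℝ] F₂ →L[ℝ] F₃) {m : β → α → F₁} (hcont : ∀ t, Continuous (m t))
    (hbdd : ∀ t, ∃ C, ∀ x, ‖m t x‖ ≤ C) (hm : ∀ x, AEStronglyMeasurable (fun t => m t x) ν)
    {G : β → Lp F₂ 2 μ} (hG : AEStronglyMeasurable G ν) {W : β → Lp F₃ 2 μ}
    (hW : ∀ t, W t =ᵐ[μ] fun x => B (m t x) (G t x)) : AEStronglyMeasurable W ν := by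
  let π : ℕ → SimpleFunc α α := fun k => SimpleFunc.nearestPt (denseSeq α) k
  have hπ : ∀ x, Tendsto (fun k => π k x) atTop (𝓝 x) := fun x =>
    SimpleFunc.tendsto_nearestPt ((denseRange_denseSeq α).closure_range ▸ mem_univ x)
  let P : ℕ → α → Lp F₂ 2 μ →L[ℝ] Lp F₂ 2 μ := fun k y =>
    (ContinuousLinearMap.lsmul ℝ ℝ).holderL μ ⊤ 2 2
      (indicatorConstLp ⊤ ((π k).measurableSet_fiber y) (measure_ne_top μ _) (1 : ℝ))
  let V : ℕ → β → Lp F₃ 2 μ := fun k t =>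
    ∑ y ∈ (π k).range, B.compLpL₂ 2 μ (m t y) (P k y (G t))
  have hVm : ∀ k, AEStronglyMeasurable (V k) ν := fun k => by
    refine Finset.aestronglyMeasurable_fun_sum _ fun y _ => ?_
    exact (B.compLpL₂ 2 μ).aestronglyMeasurable_comp₂ (hm y)
      ((P k y).continuous.comp_aestronglyMeasurable hG)
  have hVeq : ∀ k t, V k t =ᵐ[μ] fun x => B (m t (π k x)) (G t x) := fun k t => by
    have hP : ∀ᵐ x ∂μ, ∀ y : (π k).range, (B.compLpL₂ 2 μ (m t y) (P k y (G t))) x =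
        B (m t y) (((π k) ⁻¹' {(y : α)}).indicator (fun _ => (1 : ℝ)) x • G t x) := by
      rw [ae_all_iff]
      intro y
      filter_upwards [(B (m t y)).coeFn_compLp (P k y (G t)),
        (ContinuousLinearMap.lsmul ℝ ℝ).coeFn_holder (r := 2) (indicatorConstLp ⊤
          ((π k).measurableSet_fiber y) (measure_ne_top μ _) (1 : ℝ)) (G t),
        indicatorConstLp_coeFn (p := ⊤) (hs := (π k).measurableSet_fiber (y : α))
          (hμs := measure_ne_top μ _) (c := (1 : ℝ))] with x h1 h2 h3
      refine h1.trans ?_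
      congr 1
      refine h2.trans ?_
      rw [h3]
      rfl
    filter_upwards [Lp.coeFn_fun_finsetSum (π k).range
      (fun y => B.compLpL₂ 2 μ (m t y) (P k y (G t))), hP] with x h1 h2
    have h3 : ∀ y ∈ (π k).range, (B.compLpL₂ 2 μ (m t y) (P k y (G t))) x =
        B (m t y) (((π k) ⁻¹' {y}).indicator (fun _ => (1 : ℝ)) x • G t x) :=
      fun y hy => h2 ⟨y, hy⟩
    refine h1.trans ?_
    rw [Finset.sum_congr rfl h3,
      Finset.sum_eq_single_of_mem (π k x) ((π k).mem_range_self x)]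
    · simp
    · intro y _ hy
      rw [indicator_of_notMem (by simpa using hy.symm)]
      simp
  refine aestronglyMeasurable_of_tendsto_ae atTop hVm (Eventually.of_forall fun t => ?_)
  obtain ⟨C, hC⟩ := hbdd t
  rw [Lp.tendsto_Lp_iff_tendsto_eLpNorm']
  refine tendsto_eLpNorm_of_dominated (h := fun x => (‖B‖ * C) * ‖G t x‖)
    (fun k => Lp.aestronglyMeasurable _) (Lp.memLp _) ((Lp.memLp (G t)).norm.const_mul _)
    (fun k => ?_) ?_
  · filter_upwards [hVeq k t] with x hx
    rw [hx]
    refine (B.le_opNorm₂ _ _).trans ((mul_le_mul_of_nonneg_right ?_ (norm_nonneg _)).trans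
      (Real.le_norm_self _))
    gcongr
    exact hC _
  · filter_upwards [ae_all_iff.2 fun k => hVeq k t, hW t] with x h1 h2
    rw [h2]
    simp only [h1]
    have h3 := ((hcont t).tendsto x).comp (hπ x)
    exact ((B.flip (G t x)).continuous.tendsto _).comp h3

variable {d : ℕ} {Ω : Opens (EuclideanSpace ℝ (Fin d))} {g h : ℝ → ℝ}

lemma aestronglyMeasurable_modPair
    (hΩ : Bornology.IsBounded (Ω : Set (EuclideanSpace ℝ (Fin d))))
    (H : IsNemytskiiPair g h) (hg : Continuous g) (hh : Continuous h)
    {β : Type*} [MeasurableSpace β] {ν : Measure β}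
    {ψ : β → EuclideanSpace ℝ (Fin d) → ℝ}
    {Ψ : β → EuclideanSpace ℝ (Fin d) → EuclideanSpace ℝ (Fin d)}
    (M : ∀ t, IsMultiplier (ψ t) (Ψ t))
    (hψ : ∀ x, AEStronglyMeasurable (fun t => ψ t x) ν)
    (hΨ : ∀ x, AEStronglyMeasurable (fun t => Ψ t x) ν)
    {u : β → SobolevPair Ω} (hu : AEStronglyMeasurable u ν) :
    AEStronglyMeasurable (fun t => modPair H (M t) (u t)) ν := by
  have : IsFiniteMeasure (spaceMeasure Ω) := ⟨by simpa using hΩ.measure_lt_top⟩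
  have M1 : IsMultiplier (d := d) (fun _ => 1) (fun _ => 0) :=
    ⟨continuous_const, continuous_const, 1, by simp⟩
  have hbase : AEStronglyMeasurable (fun t => modPair H M1 (u t)) ν :=
    (continuous_modPair hΩ H M1 hg hh).comp_aestronglyMeasurable hu
  have hA : AEStronglyMeasurable (fun t => (modPair H M1 (u t)).fst) ν :=
    (WithLp.fstL 2 ℝ _ _).continuous.comp_aestronglyMeasurable hbase
  have hB : AEStronglyMeasurable (fun t => (modPair H M1 (u t)).snd) ν :=
    (WithLp.sndL 2 ℝ _ _).continuous.comp_aestronglyMeasurable hbase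
  have hψb : ∀ t, ∃ C, ∀ x, ‖ψ t x‖ ≤ C := fun t =>
    let ⟨C, hC⟩ := (M t).bounded
    ⟨C, fun x => (hC x).1⟩
  have hΨb : ∀ t, ∃ C, ∀ x, ‖Ψ t x‖ ≤ C := fun t =>
    let ⟨C, hC⟩ := (M t).bounded
    ⟨C, fun x => (hC x).2⟩
  -- The vector part is split into its contributions from `ψ` and from `Ψ`.
  have M2 : ∀ t, IsMultiplier (ψ t) (fun _ => 0) := fun t =>
    ⟨(M t).continuous_fst, continuous_const,
      let ⟨C, hC⟩ := (M t).bounded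
      ⟨C, fun x => ⟨(hC x).1, by simpa using (norm_nonneg _).trans (hC x).1⟩⟩⟩
  have M3 : ∀ t, IsMultiplier (fun _ => 0) (Ψ t) := fun t =>
    ⟨continuous_const, (M t).continuous_snd,
      let ⟨C, hC⟩ := (M t).bounded
      ⟨C, fun x => ⟨by simpa using (norm_nonneg _).trans (hC x).1, (hC x).2⟩⟩⟩
  have h1 : AEStronglyMeasurable (fun t => (modPair H (M t) (u t)).fst) ν := by
    refine aestronglyMeasurable_bilin (ContinuousLinearMap.lsmul ℝ ℝ)
      (fun t => (M t).continuous_fst) hψb hψ hA fun t => ?_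
    filter_upwards [modPair_fst H (M t) (u t), modPair_fst H M1 (u t)] with x h1 h2
    rw [h1, h2]
    simp
  have h2 : AEStronglyMeasurable (fun t => (modPair H (M2 t) (u t)).snd) ν := by
    refine aestronglyMeasurable_bilin (ContinuousLinearMap.lsmul ℝ ℝ)
      (fun t => (M t).continuous_fst) hψb hψ hB fun t => ?_
    filter_upwards [modPair_snd H (M2 t) (u t), modPair_snd H M1 (u t)] with x h1 h2
    rw [h1, h2]
    rw [smul_zero, zero_add, zero_add, one_mul, mul_smul]
    rfl
  have h3 : AEStronglyMeasurable (fun t => (modPair H (M3 t) (u t)).snd) ν := by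
    refine aestronglyMeasurable_bilin (ContinuousLinearMap.lsmul ℝ ℝ).flip
      (fun t => (M t).continuous_snd) hΨb hΨ hA fun t => ?_
    filter_upwards [modPair_snd H (M3 t) (u t), modPair_fst H M1 (u t)] with x h1 h2
    rw [h1, h2]
    simp
  have h4 : AEStronglyMeasurable (fun t => (modPair H (M t) (u t)).snd) ν := by
    refine (h2.add h3).congr (Eventually.of_forall fun t => ?_)
    refine Lp.ext ?_
    simp only [Pi.add_apply]
    filter_upwards [modPair_snd H (M t) (u t), modPair_snd H (M2 t) (u t),
      modPair_snd H (M3 t) (u t), Lp.coeFn_add (modPair H (M2 t) (u t)).snd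
        (modPair H (M3 t) (u t)).snd] with x h5 h6 h7 h8
    rw [h8, Pi.add_apply, h5, h6, h7]
    rw [smul_zero, zero_add, zero_mul, zero_smul, add_zero, add_comm]
  exact (WithLp.prod_continuous_toLp 2 _ _).comp_aestronglyMeasurable (h1.prodMk h4)

end Measurability

/-! ### Test functions depending on time -/

section TestFunctionsInTime

variable {d : ℕ} {Ω : Opens (EuclideanSpace ℝ (Fin d))} {T : ℝ} {φ : ℝ → 𝓓(Ω, ℝ)}

lemma norm_iteratedFDeriv_le_iSup (ψ : 𝓓(Ω, ℝ)) (k : ℕ) (x : EuclideanSpace ℝ (Fin d)) :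
    ‖iteratedFDeriv ℝ k (ψ : EuclideanSpace ℝ (Fin d) → ℝ) x‖ ≤
      ⨆ x, ‖iteratedFDeriv ℝ k (ψ : EuclideanSpace ℝ (Fin d) → ℝ) x‖ := by
  have hc : Continuous (iteratedFDeriv ℝ k (ψ : EuclideanSpace ℝ (Fin d) → ℝ)) :=
    ψ.contDiff.continuous_iteratedFDeriv (mod_cast le_top)
  obtain ⟨C, hC⟩ := (ψ.hasCompactSupport.iteratedFDeriv k).exists_bound_of_continuous hc
  exact le_ciSup (f := fun x => ‖iteratedFDeriv ℝ k (ψ : EuclideanSpace ℝ (Fin d) → ℝ) x‖)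
    ⟨C, by rintro _ ⟨y, rfl⟩; exact hC y⟩ x

/-- The `C¹`-norm (in space) of an element of `L²(I; C_0^∞(Ω))`, as a function of time. -/
lemma IsL2TestFunction.exists_bound (hφ : IsL2TestFunction T φ) :
    ∃ N : ℝ → ℝ, MemLp N 2 (timeMeasure T) ∧ ∀ t x, ‖φ t x‖ ≤ N t ∧
      ‖∇ (φ t : EuclideanSpace ℝ (Fin d) → ℝ) x‖ ≤ N t := by
  refine ⟨_, (hφ.memLp 0).add (hφ.memLp 1), fun t x => ?_⟩
  have h0 := norm_iteratedFDeriv_le_iSup (φ t) 0 x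
  have h1 := norm_iteratedFDeriv_le_iSup (φ t) 1 x
  have h0' := (norm_nonneg _).trans h0
  have h1' := (norm_nonneg _).trans h1
  rw [norm_gradient_eq, ← norm_iteratedFDeriv_one,
    ← norm_iteratedFDeriv_zero (𝕜 := ℝ) (f := (φ t : EuclideanSpace ℝ (Fin d) → ℝ))]
  exact ⟨h0.trans (le_add_of_nonneg_right h1'), h1.trans (le_add_of_nonneg_left h0')⟩

lemma IsL2TestFunction.aestronglyMeasurable (hφ : IsL2TestFunction T φ)
    (x : EuclideanSpace ℝ (Fin d)) : AEStronglyMeasurable (fun t => φ t x) (timeMeasure T) :=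
  (hφ.aemeasurable x).aestronglyMeasurable

lemma IsL2TestFunction.aestronglyMeasurable_gradient (hφ : IsL2TestFunction T φ)
    (x : EuclideanSpace ℝ (Fin d)) :
    AEStronglyMeasurable (fun t => ∇ (φ t : EuclideanSpace ℝ (Fin d) → ℝ) x) (timeMeasure T) := by
  let b := EuclideanSpace.basisFun (Fin d) ℝ
  have h : ∀ v, AEStronglyMeasurable
      (fun t => fderiv ℝ (φ t : EuclideanSpace ℝ (Fin d) → ℝ) x v) (timeMeasure T) := by
    intro v
    -- Directional derivatives are limits of difference quotients with increments `v / n`.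
    have hlim : Tendsto (fun n : ℕ => ‖(n : ℝ)‖) atTop atTop :=
      tendsto_norm_atTop_atTop.comp tendsto_natCast_atTop_atTop
    refine aestronglyMeasurable_of_tendsto_ae atTop
      (f := fun (n : ℕ) t => (n : ℝ) • (φ t (x + (n : ℝ)⁻¹ • v) - φ t x)) (fun n => ?_)
      (Eventually.of_forall fun t =>
        (differentiable_testFunction (φ t) x).hasFDerivAt.lim v hlim)
    exact ((hφ.aestronglyMeasurable _).sub (hφ.aestronglyMeasurable _)).const_smul (n : ℝ)
  have h2 : (fun t => ∇ (φ t : EuclideanSpace ℝ (Fin d) → ℝ) x) = fun t =>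
      ∑ i, fderiv ℝ (φ t : EuclideanSpace ℝ (Fin d) → ℝ) x (b i) • b i := by
    ext1 t
    rw [← b.sum_repr' (∇ (φ t : EuclideanSpace ℝ (Fin d) → ℝ) x)]
    refine Finset.sum_congr rfl fun i _ => ?_
    rw [real_inner_comm, inner_gradient_left]
  rw [h2]
  exact Finset.aestronglyMeasurable_fun_sum _ fun i _ => (h _).smul_const _

end TestFunctionsInTime

/-! ### Duality pairing and traces in time -/

lemma integrable_pairing {T : ℝ} {V : Type} [NormedAddCommGroup V] [NormedSpace ℝ V]
    (q : L2I T (StrongDual ℝ V)) (w : L2I T V) :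
    Integrable (fun t => q t (w t)) (timeMeasure T) := by
  have h := ContinuousLinearMap.memLp_of_bilin (𝕜 := ℝ) (E := StrongDual ℝ V) (F := V) (G := ℝ) 1
    (ContinuousLinearMap.id ℝ (StrongDual ℝ V)) (Lp.memLp q) (Lp.memLp w)
  exact memLp_one_iff_integrable.1 h

section Traces

lemma eqOn_Icc_of_ae_eq {T : ℝ} {X : Type*} [TopologicalSpace X] [T2Space X] (hT : 0 < T)
    {c c' : ℝ → X} (hc : ContinuousOn c (Icc 0 T)) (hc' : ContinuousOn c' (Icc 0 T))
    (h : c =ᵐ[timeMeasure T] c') : EqOn c c' (Icc 0 T) :=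
  Measure.eqOn_Icc_of_ae_eq volume hT.ne
    (by rwa [Measure.restrict_congr_set Ioo_ae_eq_Icc.symm]) hc hc'

variable {T : ℝ} {H : Type} [NormedAddCommGroup H] [NormedSpace ℝ H]

/-- Since `z(0) = 0`, the trace `z(T)` is a continuous function of `ż`. -/
lemma HasTrace.eq_integral_dot [CompleteSpace H] (hT : 0 < T) (z : H1IStar T H) {a : H}
    (h : HasTrace (H1IStar.fn z) T a) : a = ∫ t in Ioo 0 T, H1IStar.dot z t := by
  obtain ⟨c, hc, hcv, rfl⟩ := h
  obtain ⟨c', hc', hcv', h0⟩ := z.2.2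
  have h1 := eqOn_Icc_of_ae_eq hT hc hc' (hcv.trans hcv'.symm) (left_mem_Icc.2 hT.le)
  have h2 := HasWeakDeriv.sub_eq_integral hT z.2.1 hc hcv (right_mem_Icc.2 hT.le)
  rw [h1, h0, sub_zero, intervalIntegral.integral_of_le hT.le, integral_Ioc_eq_integral_Ioo] at h2
  exact h2

lemma continuous_integral_L2I [CompleteSpace H] :
    Continuous fun v : L2I T H => ∫ t in Ioo 0 T, v t := by
  let one : L2I T ℝ := (memLp_const (1 : ℝ)).toLp _
  have h : ∀ v : L2I T H, (ContinuousLinearMap.lsmul ℝ ℝ).lpPairing (timeMeasure T) 2 2 one v =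
      ∫ t in Ioo 0 T, v t := fun v => by
    rw [ContinuousLinearMap.lpPairing_eq_integral]
    refine integral_congr_ae ?_
    filter_upwards [(memLp_const (1 : ℝ)).coeFn_toLp (p := 2) (μ := timeMeasure T)] with t ht
    change ((memLp_const (1 : ℝ)).toLp _ : L2I T ℝ) t • v t = v t
    rw [ht, one_smul]
  simp_rw [← h]
  exact ContinuousLinearMap.continuous _

lemma continuous_H1IStar_fn : Continuous (H1IStar.fn : H1IStar T H → L2I T H) :=
  (WithLp.fstL 2 ℝ _ _).continuous.comp continuous_subtype_val

lemma continuous_H1IStar_dot : Continuous (H1IStar.dot : H1IStar T H → L2I T H) :=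
  (WithLp.sndL 2 ℝ _ _).continuous.comp continuous_subtype_val

end Traces

/-! ### The regularized modulus -/

section RegularizedAbs

variable {a : ℝ → ℝ → ℝ} {ρ : ℝ}

lemma IsRegularizedAbs.deriv2_nonneg (ha : IsRegularizedAbs a) (hρ : 0 < ρ) (v : ℝ) :
    0 ≤ deriv (deriv (a ρ)) v := by
  have hd : Differentiable ℝ (a ρ) := (ha.contDiff ρ hρ).differentiable (by simp)
  have hmono : Monotone (deriv (a ρ)) :=
    monotoneOn_univ.1 ((ha.convex ρ hρ).monotoneOn_deriv fun x _ => hd x)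
  exact hmono.deriv_nonneg

lemma IsRegularizedAbs.continuous_deriv2 (ha : IsRegularizedAbs a) (hρ : 0 < ρ) :
    Continuous (deriv (deriv (a ρ))) := by
  obtain ⟨K, hK⟩ := ha.lipschitz ρ hρ
  exact hK.continuous

lemma IsRegularizedAbs.deriv2_eq_zero (ha : IsRegularizedAbs a) (hρ : 0 < ρ) {v : ℝ}
    (hv : ρ < |v|) : deriv (deriv (a ρ)) v = 0 := by
  -- On each of the half-lines `v < -ρ` and `v > ρ` the regularization is affine.
  have key : ∀ {s : Set ℝ} {σ : ℝ}, IsOpen s → (∀ w ∈ s, a ρ w = σ * w) → v ∈ s →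
      deriv (deriv (a ρ)) v = 0 := by
    intro s σ hs h hv
    have h1 : ∀ w ∈ s, deriv (a ρ) w = σ := fun w hw => by
      have : a ρ =ᶠ[𝓝 w] fun w => σ * w := by
        filter_upwards [hs.mem_nhds hw] with y hy using h y hy
      rw [this.deriv_eq]
      simp
    have h2 : deriv (a ρ) =ᶠ[𝓝 v] fun _ => σ := by
      filter_upwards [hs.mem_nhds hv] with y hy using h1 y hy
    rw [h2.deriv_eq]
    simp
  rcases lt_abs.1 hv with h | h
  · refine key (σ := 1) isOpen_Ioi (fun w hw => ?_) (mem_Ioi.2 h)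
    have hw' : ρ < w := hw
    have h3 : |w| = w := abs_of_pos (hρ.trans hw')
    rw [ha.eq_abs ρ hρ w (by rw [h3]; exact hw'.le), h3, one_mul]
  · refine key (σ := -1) isOpen_Iio (fun w hw => ?_) (mem_Iio.2 (by linarith : v < -ρ))
    have hw' : w < -ρ := hw
    have h3 : |w| = -w := abs_of_neg (by linarith)
    rw [ha.eq_abs ρ hρ w (by rw [h3]; linarith), h3, neg_one_mul]

/-- The factor `|v|_ρ'' |v|` is small against `(|v|_ρ'')^{1/2}`, since `|v|_ρ'' ≤ 2/ρ` vanishes for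
`|v| > ρ`; Young's inequality then gives this form of the estimate. -/
lemma IsRegularizedAbs.deriv2_mul_le (ha : IsRegularizedAbs a) (hρ : 0 < ρ) {v g ψ C s : ℝ}
    (hg : |g| ≤ |v|) (hψ : |ψ| ≤ C) :
    |deriv (deriv (a ρ)) v * s * (ψ * g)| ≤ √ρ * (deriv (deriv (a ρ)) v * s ^ 2 + 2 * C ^ 2) := by
  have h0 := ha.deriv2_nonneg hρ v
  have h2 := ha.deriv2_le ρ hρ v
  have hC : 0 ≤ C := (abs_nonneg _).trans hψ
  set D := deriv (deriv (a ρ)) v with hD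
  rcases lt_or_ge ρ |v| with hv | hv
  · rw [hD, ha.deriv2_eq_zero hρ hv]
    simp
    positivity
  · have hr : √ρ * √ρ = ρ := Real.mul_self_sqrt hρ.le
    have hr0 : 0 < √ρ := Real.sqrt_pos.2 hρ
    have h3 : |ψ * g| ≤ C * ρ := by
      rw [abs_mul]
      exact mul_le_mul hψ (hg.trans hv) (abs_nonneg _) hC
    have h4 : D * ρ ≤ 2 := by
      rwa [le_div_iff₀ hρ] at h2
    rw [abs_mul, abs_mul, abs_of_nonneg h0]
    calc D * |s| * |ψ * g| ≤ D * |s| * (C * ρ) := by gcongr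
      _ = √ρ * (D * (|s| * (C * √ρ))) := by linear_combination (-(D * |s| * C)) * hr
      _ ≤ √ρ * (D * (s ^ 2 + C ^ 2 * ρ)) := by
        gcongr
        have h5 := sq_nonneg (|s| - C * √ρ)
        nlinarith [sq_abs s, sq_nonneg (C * √ρ), sq_nonneg s]
      _ ≤ √ρ * (D * s ^ 2 + 2 * C ^ 2) := by
        gcongr
        nlinarith [sq_nonneg C]

end RegularizedAbs

/-! ### Uniform estimates for the adjoint system -/

section Energy

lemma exists_forall_norm_le_of_continuousOn_Icc {E : Type*} [NormedAddCommGroup E] {c : ℝ → E}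
    {a b : ℝ} (hab : a ≤ b) (hc : ContinuousOn c (Icc a b)) :
    ∃ t₀ ∈ Icc a b, ∀ t ∈ Icc a b, ‖c t‖ ≤ ‖c t₀‖ :=
  isCompact_Icc.exists_isMaxOn (nonempty_Icc.2 hab) hc.norm

variable {d : ℕ} {Ω : Opens (EuclideanSpace ℝ (Fin d))} {T : ℝ}

lemma norm_sq_le_apply_inverse_laplacian {G : Hneg Ω →L[ℝ] H01 Ω}
    (hG : ∀ (p : Hneg Ω) (v : H01 Ω), inner ℝ (gradL Ω (G p)) (gradL Ω v) = p v) (p : Hneg Ω) :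
    ‖p‖ ^ 2 ≤ p (G p) := by
  have h : ‖p‖ ≤ ‖gradL Ω (G p)‖ := by
    refine p.opNorm_le_bound (norm_nonneg _) fun v => ?_
    rw [← hG p v]
    exact (norm_inner_le_norm _ _).trans
      (mul_le_mul_of_nonneg_left (norm_gradL_le v) (norm_nonneg _))
  rw [← hG p (G p), real_inner_self_eq_norm_sq]
  gcongr

/-- The energy estimate for `q̇ = L ξ - f`, obtained by testing with `G q`, where `G` is a symmetric
positive definite operator inverting `L` (this enters only through the tested equation `hev`).  The
bound is uniform in the data: it involves `f` and `q(T)` only through bounds for their norms. -/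
lemma energy_estimate {V : Type} [NormedAddCommGroup V] [NormedSpace ℝ V] (hT : 0 < T)
    {G : StrongDual ℝ V →L[ℝ] V} (hGsymm : ∀ p r : StrongDual ℝ V, p (G r) = r (G p))
    (hGpos : ∀ p : StrongDual ℝ V, ‖p‖ ^ 2 ≤ p (G p))
    {γ A K : ℝ} (hγ : 0 ≤ γ) (hGb : ∀ p : StrongDual ℝ V, ‖G p‖ ≤ γ * ‖p‖)
    {q q' f : L2I T (StrongDual ℝ V)} {ξ : L2I T V} (hq : HasWeakDeriv q q')
    (hev : ∀ᵐ t ∂timeMeasure T, q' t (G (q t)) = q t (ξ t) - f t (G (q t)))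
    (hpos : ∀ᵐ t ∂timeMeasure T, 0 ≤ q t (ξ t))
    (hA0 : 0 ≤ A) (hA : ∀ v : L2I T V, |∫ t in Ioo 0 T, f t (v t)| ≤ A * ‖v‖)
    {qT : StrongDual ℝ V} (hqT : HasTrace q T qT) (hK : ‖qT‖ ≤ K) {κ M : ℝ}
    (hκ : κ = (measureUnivNNReal (timeMeasure T) : ℝ) ^ ((2 : ENNReal).toReal⁻¹))
    (hM : M = 1 + γ * K ^ 2 + 2 * A * γ * κ) :
    (∀ᵐ t ∂timeMeasure T, ‖q t‖ ≤ M) ∧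
      ∫ t in Ioo 0 T, q t (ξ t) ≤ γ * K ^ 2 + 2 * A * γ * κ * M := by
  obtain ⟨c, hc, hcq, rfl⟩ := hqT
  have hK0 : 0 ≤ K := (norm_nonneg _).trans hK
  have hκ0 : 0 ≤ κ := by rw [hκ]; positivity
  have hTm : T ∈ Icc 0 T := right_mem_Icc.2 hT.le
  let B : StrongDual ℝ V →L[ℝ] StrongDual ℝ V →L[ℝ] ℝ :=
    (ContinuousLinearMap.compL ℝ (StrongDual ℝ V) V ℝ).flip G
  have hB : ∀ p r, B p r = p (G r) := fun _ _ => rfl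
  have hBsymm : ∀ p r, B p r = B r p := hGsymm
  have hGle : ∀ p : StrongDual ℝ V, p (G p) ≤ γ * ‖p‖ ^ 2 := fun p => by
    calc p (G p) ≤ ‖p (G p)‖ := Real.le_norm_self _
      _ ≤ ‖p‖ * ‖G p‖ := p.le_opNorm _
      _ ≤ ‖p‖ * (γ * ‖p‖) := by gcongr; exact hGb p
      _ = γ * ‖p‖ ^ 2 := by ring
  -- The test function `G q`, as an element of `L²(I; V)`.
  have hvmem : MemLp (fun t => G (q t)) 2 (timeMeasure T) :=
    (Lp.memLp (q)).of_le_mul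
      (G.continuous.comp_aestronglyMeasurable (Lp.aestronglyMeasurable _))
      (Eventually.of_forall fun t => hGb _)
  -- A uniform bound `m` for the continuous representative, attained at `t₀`.
  obtain ⟨t₀, ht₀, hmax⟩ := exists_forall_norm_le_of_continuousOn_Icc hT.le hc
  set m := ‖c t₀‖ with hm
  have hm0 : 0 ≤ m := norm_nonneg (c t₀)
  have hcm : ∀ t ∈ Icc 0 T, ‖c t‖ ≤ m := fun t ht => hmax t ht
  have hqm : ∀ᵐ t ∂timeMeasure T, ‖q t‖ ≤ m := by
    filter_upwards [hcq, ae_restrict_mem measurableSet_Ioo] with t ht htm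
    rw [← ht]
    exact hcm t (Ioo_subset_Icc_self htm)
  have hqL2 : ‖q‖ ≤ κ * m := by
    rw [hκ]
    exact Lp.norm_le_of_ae_bound hm0 hqm
  have hIoo : ∀ {t : ℝ}, t ∈ Icc 0 T → Ioo t T ⊆ Ioo 0 T := fun ht => Ioo_subset_Ioo_left ht.1
  have hload : ∀ t ∈ Icc 0 T, |∫ s in Ioo t T, f s (G (q s))| ≤ A * (γ * (κ * m)) := by
    intro t ht
    let v : L2I T (V) := (hvmem.indicator (s := Ioo t T) measurableSet_Ioo).toLp _
    have hv : ‖v‖ ≤ γ * ‖q‖ := by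
      refine Lp.norm_le_mul_norm_of_ae_le_mul ?_
      filter_upwards [(hvmem.indicator (s := Ioo t T) measurableSet_Ioo).coeFn_toLp] with s hs
      rw [hs]
      exact (norm_indicator_le_norm_self _ _).trans (hGb _)
    have h1 : ∫ s in Ioo t T, f s (G (q s)) = ∫ s in Ioo 0 T, f s (v s) := by
      rw [← inter_eq_right.2 (hIoo ht), ← setIntegral_indicator measurableSet_Ioo]
      refine integral_congr_ae ?_
      filter_upwards [(hvmem.indicator (s := Ioo t T) measurableSet_Ioo).coeFn_toLp] with s hs
      rw [hs]
      by_cases hst : s ∈ Ioo t T <;> simp [hst]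
    rw [h1]
    refine (hA v).trans (mul_le_mul_of_nonneg_left (hv.trans ?_) hA0)
    gcongr
  have hfi : Integrable (fun t => f t (G (q t))) (timeMeasure T) := by
    refine (integrable_pairing f (hvmem.toLp _)).congr ?_
    filter_upwards [hvmem.coeFn_toLp] with t ht
    rw [ht]
  have hqi := integrable_pairing (q) ξ
  have henergy : ∀ t ∈ Icc 0 T, c T (G (c T)) - c t (G (c t)) =
      2 * ∫ s in Ioo t T, (q s (ξ s) - f s (G (q s))) := by
    intro t ht
    have h1 := bilin_sub_eq_integral hT (L2I.intervalIntegrable q' hT)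
      (fun t ht => HasWeakDeriv.sub_eq_integral hT hq hc hcq ht) B hBsymm ht
    rw [hB, hB, intervalIntegral.integral_of_le ht.2, integral_Ioc_eq_integral_Ioo] at h1
    rw [h1]
    congr 1
    refine integral_congr_ae (ae_restrict_of_ae_restrict_of_subset (hIoo ht) ?_)
    filter_upwards [hcq, hev] with s hs hs'
    rw [hB, hs, hs']
  have hsplit : ∀ t ∈ Icc 0 T, c t (G (c t)) + 2 * ∫ s in Ioo t T, q s (ξ s) ≤
      γ * K ^ 2 + 2 * (A * (γ * (κ * m))) := by
    intro t ht
    have h1 := henergy t ht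
    rw [integral_sub (hqi.mono_measure (Measure.restrict_mono (hIoo ht) le_rfl))
      (hfi.mono_measure (Measure.restrict_mono (hIoo ht) le_rfl))] at h1
    have h2 := (abs_le.1 (hload t ht)).2
    have h3 : c T (G (c T)) ≤ γ * K ^ 2 := by
      refine (hGle _).trans ?_
      gcongr
    linarith
  have hnonneg : ∀ t ∈ Icc 0 T, 0 ≤ ∫ s in Ioo t T, q s (ξ s) := fun t ht =>
    integral_nonneg_of_ae (ae_restrict_of_ae_restrict_of_subset (hIoo ht) hpos)
  have hmM : m ≤ M := by
    have h1 := hsplit t₀ ht₀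
    have h2 := hGpos (c t₀)
    have h3 := hnonneg t₀ ht₀
    have h4 : m ^ 2 ≤ γ * K ^ 2 + 2 * A * γ * κ * m := by
      rw [hm] at *
      linarith
    -- `m² ≤ α + β m` implies `m ≤ 1 + α + β`.
    have hα : 0 ≤ γ * K ^ 2 := by positivity
    have hβ : 0 ≤ 2 * A * γ * κ := by positivity
    rw [hM]
    by_contra hlt
    push Not at hlt
    nlinarith
  refine ⟨hqm.mono fun t ht => ht.trans hmM, ?_⟩
  have h0 : (0 : ℝ) ∈ Icc 0 T := left_mem_Icc.2 hT.le
  have h1 := hsplit 0 h0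
  have h2 := hGpos (c 0)
  have h3 := hnonneg 0 h0
  have h4 : 2 * (A * (γ * (κ * m))) ≤ 2 * A * γ * κ * M := by
    have : 2 * (A * (γ * (κ * m))) = 2 * A * γ * κ * m := by ring
    rw [this]
    gcongr
  nlinarith [sq_nonneg ‖c 0‖]

lemma inverse_laplacian_symm {G : Hneg Ω →L[ℝ] H01 Ω}
    (hG : ∀ (p : Hneg Ω) (v : H01 Ω), inner ℝ (gradL Ω (G p)) (gradL Ω v) = p v) (p r : Hneg Ω) :
    p (G r) = r (G p) :=
  (hG p (G r)).symm.trans ((real_inner_comm _ _).trans (hG r (G p)))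

lemma laplacian_apply_inverse_laplacian {G : Hneg Ω →L[ℝ] H01 Ω}
    (hG : ∀ (p : Hneg Ω) (v : H01 Ω), inner ℝ (gradL Ω (G p)) (gradL Ω v) = p v)
    (u : H01 Ω) (p : Hneg Ω) : laplacian u (G p) = -p u :=
  congrArg Neg.neg ((real_inner_comm (gradL Ω (G p)) (gradL Ω u)).trans (hG p u))

/-- The energy estimate, obtained by testing `-q̇ = Δξ + j₁'(z)` with `(-Δ)⁻¹ q`.  The constants
depend on the solution only through bounds for `j₁'(z)` and `j₂'(z(T))`. -/
lemma IsAdjointSolution.energy_estimate (hT : 0 < T) {G : Hneg Ω →L[ℝ] H01 Ω}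
    (hG : ∀ (p : Hneg Ω) (v : H01 Ω), inner ℝ (gradL Ω (G p)) (gradL Ω v) = p v)
    {γ A K : ℝ} (hγ : 0 ≤ γ) (hGb : ∀ p : Hneg Ω, ‖G p‖ ≤ γ * ‖p‖)
    {a : ℝ → ℝ → ℝ} {j₁ : L2I T (H01 Ω) → ℝ} {j₂ : H01 Ω → ℝ} {ρ : ℝ}
    {z : H1IStar T (H01 Ω)} {q : H1I T (Hneg Ω)} {ξ : L2I T (H01 Ω)}
    (hsol : IsAdjointSolution a j₁ j₂ ρ z q ξ)
    (hpos : ∀ᵐ t ∂timeMeasure T, 0 ≤ H1I.fn q t (ξ t))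
    (hA0 : 0 ≤ A) (hA : ∀ v, |fderiv ℝ j₁ (H1IStar.fn z) v| ≤ A * ‖v‖)
    (hK : ‖fderiv ℝ j₂ (∫ t in Ioo 0 T, H1IStar.dot z t)‖ ≤ K) {κ M : ℝ}
    (hκ : κ = (measureUnivNNReal (timeMeasure T) : ℝ) ^ ((2 : ENNReal).toReal⁻¹))
    (hM : M = 1 + γ * K ^ 2 + 2 * A * γ * κ) :
    (∀ᵐ t ∂timeMeasure T, ‖H1I.fn q t‖ ≤ M) ∧
      ∫ t in Ioo 0 T, H1I.fn q t (ξ t) ≤ γ * K ^ 2 + 2 * A * γ * κ * M := by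
  obtain ⟨f, hf, hev⟩ := hsol.evolution
  obtain ⟨zT, hzT, hqT⟩ := hsol.terminal
  rw [← hzT.eq_integral_dot hT] at hK
  refine RateIndep.energy_estimate hT (inverse_laplacian_symm hG)
    (norm_sq_le_apply_inverse_laplacian hG) hγ hGb
    (f := f) q.2 ?_ hpos hA0 (fun v => ?_) hqT hK hκ hM
  · filter_upwards [hev] with s hs
    have h3 := laplacian_apply_inverse_laplacian hG (ξ s) (H1I.fn q s)
    have h4 := DFunLike.congr_fun hs (G (H1I.fn q s))
    have h5 : -(H1I.dot q s (G (H1I.fn q s))) =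
        laplacian (ξ s) (G (H1I.fn q s)) + f s (G (H1I.fn q s)) := h4
    change H1I.dot q s (G (H1I.fn q s)) = H1I.fn q s (ξ s) - f s (G (H1I.fn q s))
    linarith
  · rw [← hf v]
    exact hA v

lemma integrable_deriv2_mul {a : ℝ → ℝ → ℝ} (ha : IsRegularizedAbs a) {ρ : ℝ} (hρ : 0 < ρ)
    (u v w : Lp ℝ 2 (spaceMeasure Ω)) :
    Integrable (fun x => deriv (deriv (a ρ)) (u x) * v x * w x) (spaceMeasure Ω) := by
  have h1 : Integrable (fun x => v x * w x) (spaceMeasure Ω) :=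
    (Lp.memLp v).integrable_mul (Lp.memLp w)
  have h2 := h1.bdd_mul (c := 2 / ρ) ((ha.continuous_deriv2 hρ).comp_aestronglyMeasurable
    (Lp.aestronglyMeasurable u)) (Eventually.of_forall fun x => by
      rw [Real.norm_of_nonneg (ha.deriv2_nonneg hρ _)]
      exact ha.deriv2_le ρ hρ _)
  refine h2.congr (Eventually.of_forall fun x => ?_)
  simp only
  ring

/-- The elliptic equation tested with `ξ`. -/
lemma IsAdjointSolution.apply_self {a : ℝ → ℝ → ℝ}
    {j₁ : L2I T (H01 Ω) → ℝ} {j₂ : H01 Ω → ℝ} {ρ : ℝ}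
    {z : H1IStar T (H01 Ω)} {q : H1I T (Hneg Ω)} {ξ : L2I T (H01 Ω)}
    (hsol : IsAdjointSolution a j₁ j₂ ρ z q ξ) :
    ∀ᵐ t ∂timeMeasure T, H1I.fn q t (ξ t) = ρ * ‖gradL Ω (ξ t)‖ ^ 2 +
      ∫ x in Ω, deriv (deriv (a ρ)) (H01.fn (H1IStar.dot z t) x) * H01.fn (ξ t) x ^ 2 := by
  filter_upwards [hsol.elliptic] with t ht
  have h1 : laplacian (ξ t) (ξ t) = -‖gradL Ω (ξ t)‖ ^ 2 := by
    rw [← real_inner_self_eq_norm_sq]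
    rfl
  rw [← ht (ξ t), h1]
  simp only [pow_two, mul_assoc]
  ring

lemma IsAdjointSolution.apply_self_nonneg {a : ℝ → ℝ → ℝ} (ha : IsRegularizedAbs a)
    {j₁ : L2I T (H01 Ω) → ℝ} {j₂ : H01 Ω → ℝ} {ρ : ℝ} (hρ : 0 < ρ)
    {z : H1IStar T (H01 Ω)} {q : H1I T (Hneg Ω)} {ξ : L2I T (H01 Ω)}
    (hsol : IsAdjointSolution a j₁ j₂ ρ z q ξ) :
    ∀ᵐ t ∂timeMeasure T, 0 ≤ H1I.fn q t (ξ t) := by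
  filter_upwards [hsol.apply_self] with t ht
  rw [ht]
  exact add_nonneg (by positivity) (integral_nonneg fun x =>
    mul_nonneg (ha.deriv2_nonneg hρ _) (sq_nonneg _))

set_option maxHeartbeats 400000 in
/-- The adjoint variable `q` nearly annihilates the functions `ψ g(ż)` with `|g| ≤ |·|`: in the
elliptic equation both terms are small in terms of the dissipation
`⟨q, ξ⟩ = ρ ‖∇ξ‖² + ∫_Ω |ż|_ρ'' ξ²`, because `ρ = √ρ √ρ` in the first one and `|ż|_ρ''` vanishes for
`|ż| > ρ` in the second one. -/
lemma IsAdjointSolution.abs_apply_le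
    (hΩ : Bornology.IsBounded (Ω : Set (EuclideanSpace ℝ (Fin d))))
    {a : ℝ → ℝ → ℝ} (ha : IsRegularizedAbs a)
    {j₁ : L2I T (H01 Ω) → ℝ} {j₂ : H01 Ω → ℝ} {ρ : ℝ} (hρ : 0 < ρ)
    {z : H1IStar T (H01 Ω)} {q : H1I T (Hneg Ω)} {ξ : L2I T (H01 Ω)}
    (hsol : IsAdjointSolution a j₁ j₂ ρ z q ξ) {C : ℝ} :
    ∀ᵐ t ∂timeMeasure T, ∀ (w : H01 Ω) (ψ : EuclideanSpace ℝ (Fin d) → ℝ) (g : ℝ → ℝ),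
      (∀ x, |ψ x| ≤ C) → (∀ v, |g v| ≤ |v|) →
      (H01.fn w =ᵐ[spaceMeasure Ω] fun x => ψ x * g (H01.fn (H1IStar.dot z t) x)) →
      |H1I.fn q t w| ≤
        √ρ * (H1I.fn q t (ξ t) + ‖w‖ ^ 2 +
          2 * C ^ 2 * volume.real (Ω : Set (EuclideanSpace ℝ (Fin d)))) := by
  have : IsFiniteMeasure (spaceMeasure Ω) := ⟨by simpa using hΩ.measure_lt_top⟩
  filter_upwards [hsol.elliptic, hsol.apply_self] with t ht ht' w ψ g hψ hg hw
  have hr : √ρ * √ρ = ρ := Real.mul_self_sqrt hρ.le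
  have hr0 : 0 < √ρ := Real.sqrt_pos.2 hρ
  have h1 : |-ρ * laplacian (ξ t) w| ≤ √ρ * (ρ * ‖gradL Ω (ξ t)‖ ^ 2 + ‖w‖ ^ 2) := by
    have h2 : laplacian (ξ t) w = -inner ℝ (gradL Ω (ξ t)) (gradL Ω w) := rfl
    have h3 : |inner ℝ (gradL Ω (ξ t)) (gradL Ω w)| ≤ ‖gradL Ω (ξ t)‖ * ‖w‖ :=
      (abs_real_inner_le_norm _ _).trans
        (mul_le_mul_of_nonneg_left (norm_gradL_le w) (norm_nonneg _))
    rw [h2, neg_mul_neg, abs_mul, abs_of_pos hρ]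
    calc ρ * |inner ℝ (gradL Ω (ξ t)) (gradL Ω w)| ≤ ρ * (‖gradL Ω (ξ t)‖ * ‖w‖) := by gcongr
      _ = √ρ * ((√ρ * ‖gradL Ω (ξ t)‖) * ‖w‖) := by
        linear_combination (-(‖gradL Ω (ξ t)‖ * ‖w‖)) * hr
      _ ≤ √ρ * (ρ * ‖gradL Ω (ξ t)‖ ^ 2 + ‖w‖ ^ 2) := by
        gcongr
        have h4 : ρ * ‖gradL Ω (ξ t)‖ ^ 2 = (√ρ * ‖gradL Ω (ξ t)‖) ^ 2 := by
          rw [mul_pow, Real.sq_sqrt hρ.le]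
        rw [h4]
        nlinarith [sq_nonneg (√ρ * ‖gradL Ω (ξ t)‖ - ‖w‖), sq_nonneg (√ρ * ‖gradL Ω (ξ t)‖),
          sq_nonneg ‖w‖]
  have hi : Integrable (fun x => deriv (deriv (a ρ)) (H01.fn (H1IStar.dot z t) x) *
      H01.fn (ξ t) x ^ 2) (spaceMeasure Ω) := by
    simpa only [pow_two, mul_assoc] using
      integrable_deriv2_mul ha hρ (H01.fn (H1IStar.dot z t)) (H01.fn (ξ t)) (H01.fn (ξ t))
  have h5 : |∫ x in Ω, deriv (deriv (a ρ)) (H01.fn (H1IStar.dot z t) x) * H01.fn (ξ t) x *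
      H01.fn w x| ≤ √ρ * ((∫ x in Ω, deriv (deriv (a ρ)) (H01.fn (H1IStar.dot z t) x) *
        H01.fn (ξ t) x ^ 2) + 2 * C ^ 2 * (volume.real (Ω : Set (EuclideanSpace ℝ (Fin d))))) := by
    calc |∫ x in Ω, deriv (deriv (a ρ)) (H01.fn (H1IStar.dot z t) x) * H01.fn (ξ t) x *
          H01.fn w x|
        ≤ ∫ x in Ω, |deriv (deriv (a ρ)) (H01.fn (H1IStar.dot z t) x) * H01.fn (ξ t) x *
          H01.fn w x| := abs_integral_le_integral_abs
      _ ≤ ∫ x in Ω, √ρ * (deriv (deriv (a ρ)) (H01.fn (H1IStar.dot z t) x) *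
          H01.fn (ξ t) x ^ 2 + 2 * C ^ 2) := by
        refine integral_mono_ae (integrable_deriv2_mul ha hρ _ _ _).abs
          ((hi.add (integrable_const _)).const_mul _) ?_
        filter_upwards [hw] with x hx
        rw [hx]
        exact ha.deriv2_mul_le hρ (hg _) (hψ x)
      _ = _ := by
        rw [integral_const_mul, integral_add hi (integrable_const _), integral_const,
          measureReal_restrict_apply_univ, smul_eq_mul, mul_comm (volume.real _)]
  rw [← ht w, ht']
  refine (abs_add_le _ _).trans ((add_le_add h1 h5).trans (le_of_eq ?_))
  ring

end Energy

/-! ### Passage to the limit in Bochner spaces -/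

section Limits

variable {ι : Type*} {l : Filter ι} {T : ℝ} {V : Type} [NormedAddCommGroup V] [NormedSpace ℝ V]

/-- The closed balls of `L^∞(I; V)` are closed in `L²(I; V)` under weak convergence, being convex
and strongly closed. -/
lemma ae_norm_le_of_weak_limit [l.NeBot] {q : ι → L2I T V} {q₀ : L2I T V}
    (hq : ∀ F : StrongDual ℝ (L2I T V), Tendsto (fun i => F (q i)) l (𝓝 (F q₀))) {M : ℝ}
    (hM : ∀ᶠ i in l, ∀ᵐ t ∂timeMeasure T, ‖q i t‖ ≤ M) :
    ∀ᵐ t ∂timeMeasure T, ‖q₀ t‖ ≤ M := by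
  let s : Set (L2I T V) := {p | ∀ᵐ t ∂timeMeasure T, ‖p t‖ ≤ M}
  have hconv : Convex ℝ s := by
    intro p hp r hr a b ha hb hab
    have hp' : ∀ᵐ t ∂timeMeasure T, ‖p t‖ ≤ M := hp
    have hr' : ∀ᵐ t ∂timeMeasure T, ‖r t‖ ≤ M := hr
    change ∀ᵐ t ∂timeMeasure T, ‖(a • p + b • r : L2I T V) t‖ ≤ M
    filter_upwards [hp', hr', Lp.coeFn_add (a • p) (b • r), Lp.coeFn_smul a p,
      Lp.coeFn_smul b r] with t h1 h2 h3 h4 h5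
    rw [h3, Pi.add_apply, h4, h5, Pi.smul_apply, Pi.smul_apply]
    calc ‖a • p t + b • r t‖ ≤ a * ‖p t‖ + b * ‖r t‖ := by
          refine (norm_add_le _ _).trans (le_of_eq ?_)
          rw [norm_smul, norm_smul, Real.norm_of_nonneg ha, Real.norm_of_nonneg hb]
      _ ≤ a * M + b * M := by gcongr
      _ = M := by rw [← add_mul, hab, one_mul]
  have hclosed : IsClosed s := by
    refine IsSeqClosed.isClosed fun p p₀ hp hlim => ?_
    obtain ⟨ns, -, hae⟩ := (tendstoInMeasure_of_tendsto_Lp hlim).exists_seq_tendsto_ae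
    have hp' : ∀ᵐ t ∂timeMeasure T, ∀ n, ‖p n t‖ ≤ M := ae_all_iff.2 hp
    change ∀ᵐ t ∂timeMeasure T, ‖p₀ t‖ ≤ M
    filter_upwards [hae, hp'] with t h1 h2
    exact le_of_tendsto h1.norm (Eventually.of_forall fun n => h2 _)
  by_contra hnot
  obtain ⟨F, u, hF, hu⟩ := geometric_hahn_banach_closed_point hconv hclosed hnot
  refine hu.not_ge (le_of_tendsto (hq F) ?_)
  filter_upwards [hM] with i hi using (hF _ hi).le

/-- Weak times strong convergence in the duality pairing. -/
lemma tendsto_integral_pairing {q : ι → L2I T (StrongDual ℝ V)} {q₀ : L2I T (StrongDual ℝ V)}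
    (hq : ∀ F : StrongDual ℝ (L2I T (StrongDual ℝ V)),
      Tendsto (fun i => F (q i)) l (𝓝 (F q₀))) {R : ℝ} (hR : ∀ᶠ i in l, ‖q i‖ ≤ R)
    {w : ι → L2I T V} {w₀ : L2I T V} (hw : Tendsto w l (𝓝 w₀)) :
    Tendsto (fun i => ∫ t in Ioo 0 T, q i t (w i t)) l (𝓝 (∫ t in Ioo 0 T, q₀ t (w₀ t))) := by
  let P : L2I T (StrongDual ℝ V) →L[ℝ] L2I T V →L[ℝ] ℝ :=
    (ContinuousLinearMap.id ℝ (StrongDual ℝ V)).lpPairing (timeMeasure T) 2 2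
  have hP : ∀ p v, P p v = ∫ t in Ioo 0 T, p t (v t) := fun p v =>
    ContinuousLinearMap.lpPairing_eq_integral _ _ _
  simp_rw [← hP]
  have h1 : Tendsto (fun i => P (q i) w₀) l (𝓝 (P q₀ w₀)) := hq (P.flip w₀)
  have h2 : Tendsto (fun i => P (q i) (w i - w₀)) l (𝓝 0) := by
    have h3 : Tendsto (fun i => ‖P‖ * R * ‖w i - w₀‖) l (𝓝 0) := by
      have h4 := (hw.sub_const w₀).norm.const_mul (‖P‖ * R)
      simpa using h4
    refine squeeze_zero_norm' ?_ h3
    filter_upwards [hR] with i hi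
    refine (P.le_opNorm₂ _ _).trans ?_
    gcongr
  have h5 := h1.add h2
  simp only [map_sub, add_sub_cancel, add_zero] at h5
  exact h5

/-- Superposition with a family of continuous maps of linear growth is continuous on `L²`. -/
lemma exists_continuous_superposition {V' : Type} [NormedAddCommGroup V'] {N : ℝ → V → V'} {L : ℝ}
    (hN : ∀ t, Continuous (N t)) (hL : ∀ t y, ‖N t y‖ ≤ L * ‖y‖)
    (hm : ∀ u : L2I T V, AEStronglyMeasurable (fun t => N t (u t)) (timeMeasure T)) :
    ∃ S : L2I T V → L2I T V', Continuous S ∧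
      ∀ u, S u =ᵐ[timeMeasure T] fun t => N t (u t) := by
  have hmem : ∀ u : L2I T V, MemLp (fun t => N t (u t)) 2 (timeMeasure T) := fun u =>
    (Lp.memLp u).of_le_mul (hm u) (Eventually.of_forall fun t => hL t _)
  refine ⟨fun u => (hmem u).toLp _, continuous_iff_seqContinuous.2 fun u u₀ hu => ?_,
    fun u => (hmem u).coeFn_toLp⟩
  refine (Lp.tendsto_Lp_iff_tendsto_eLpNorm'' _ (fun n => hmem (u n)) _ _).2 ?_
  exact tendsto_eLpNorm_superposition (fun n => Lp.memLp (u n)) (Lp.memLp u₀)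
    ((Lp.tendsto_Lp_iff_tendsto_eLpNorm' _ _).1 hu) (Eventually.of_forall hN)
    (Eventually.of_forall hL) (fun n => hm (u n)) (hm u₀)

/-- Dominated convergence in the duality pairing of `L^∞(I; V^*)` with `L¹(I; V)`. -/
lemma exists_toLp_integral_pairing_eq_zero {q : L2I T (StrongDual ℝ V)} {M : ℝ}
    (hM : ∀ᵐ t ∂timeMeasure T, ‖q t‖ ≤ M) {W : ℕ → ℝ → V} {w : ℝ → V} {g : ℝ → ℝ}
    (hW : ∀ n, AEStronglyMeasurable (W n) (timeMeasure T)) (hg : Integrable g (timeMeasure T))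
    (hWg : ∀ n t, ‖W n t‖ ≤ g t) (hlim : ∀ t, Tendsto (fun n => W n t) atTop (𝓝 (w t)))
    (hzero : ∀ n, ∫ t in Ioo 0 T, q t (W n t) = 0) :
    ∃ w' : Lp V 1 (timeMeasure T), w' =ᵐ[timeMeasure T] w ∧
      Integrable (fun t => q t (w' t)) (timeMeasure T) ∧
      ∫ t in Ioo 0 T, q t (w' t) = 0 := by
  have hw : AEStronglyMeasurable w (timeMeasure T) :=
    aestronglyMeasurable_of_tendsto_ae atTop hW (Eventually.of_forall hlim)
  have hwg : ∀ t, ‖w t‖ ≤ g t := fun t =>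
    le_of_tendsto (hlim t).norm (Eventually.of_forall fun n => hWg n t)
  have hwi : Integrable w (timeMeasure T) := hg.mono' hw (Eventually.of_forall hwg)
  have hmeas : ∀ {v : ℝ → V}, AEStronglyMeasurable v (timeMeasure T) →
      AEStronglyMeasurable (fun t => q t (v t)) (timeMeasure T) := fun hv =>
    isBoundedBilinearMap_apply.continuous.comp_aestronglyMeasurable
      ((Lp.aestronglyMeasurable q).prodMk hv)
  have hbound : ∀ᵐ t ∂timeMeasure T, ∀ v : V, ‖v‖ ≤ g t → ‖q t v‖ ≤ M * g t := by
    filter_upwards [hM] with t ht v hv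
    exact ((q t).le_opNorm v).trans (mul_le_mul ht hv (norm_nonneg _) ((norm_nonneg _).trans ht))
  have hint : Integrable (fun t => q t (w t)) (timeMeasure T) := by
    refine (hg.const_mul M).mono' (hmeas hw) ?_
    filter_upwards [hbound] with t ht using ht _ (hwg t)
  have hint0 : ∫ t in Ioo 0 T, q t (w t) = 0 := by
    refine tendsto_nhds_unique (tendsto_integral_of_dominated_convergence (fun t => M * g t)
      (fun n => hmeas (hW n)) (hg.const_mul M) (fun n => ?_)
      (Eventually.of_forall fun t => ((q t).continuous.tendsto _).comp (hlim t))) ?_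
    · filter_upwards [hbound] with t ht using ht _ (hWg n t)
    · simp only [hzero]
      exact tendsto_const_nhds
  have hcoe := (memLp_one_iff_integrable.2 hwi).coeFn_toLp
  have hcongr : (fun t => q t ((memLp_one_iff_integrable.2 hwi).toLp w t)) =ᵐ[timeMeasure T]
      fun t => q t (w t) := by
    filter_upwards [hcoe] with t ht
    rw [ht]
  exact ⟨_, hcoe, hint.congr hcongr.symm, (integral_congr_ae hcongr).trans hint0⟩

/-- The derivative of a `C¹` functional is bounded near each point. -/
lemma exists_eventually_norm_fderiv_le {E : Type*} [NormedAddCommGroup E] [NormedSpace ℝ E]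
    {j : E → ℝ} (hj : ContDiff ℝ 1 j) {x : ι → E} {x₀ : E} (hx : Tendsto x l (𝓝 x₀)) :
    ∃ A, 0 ≤ A ∧ ∀ᶠ i in l, ‖fderiv ℝ j (x i)‖ ≤ A ∧ ∀ v, |fderiv ℝ j (x i) v| ≤ A * ‖v‖ := by
  have h : Tendsto (fun i => ‖fderiv ℝ j (x i)‖) l (𝓝 ‖fderiv ℝ j x₀‖) :=
    (((hj.continuous_fderiv (by simp)).tendsto x₀).comp hx).norm
  refine ⟨‖fderiv ℝ j x₀‖ + 1, by positivity, ?_⟩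
  filter_upwards [h.eventually_lt_const (lt_add_one _)] with i hi
  exact ⟨hi.le, fun v => ((fderiv ℝ j (x i)).le_opNorm v).trans (by gcongr)⟩

lemma exists_norm_apply_le (G : StrongDual ℝ V →L[ℝ] V) :
    ∃ γ : ℝ, 0 ≤ γ ∧ ∀ p : StrongDual ℝ V, ‖G p‖ ≤ γ * ‖p‖ :=
  let ⟨γ, hγ, h⟩ := G.bound
  ⟨γ, hγ.le, h⟩

lemma tendsto_sqrt_mul_zero {E : Type*} [NormedAddCommGroup E] {l : Filter ℝ}
    (hl : l ≤ 𝓝[>] 0) {w : ℝ → E} {w₀ : E}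
    (hw : Tendsto w l (𝓝 w₀)) (C D : ℝ) :
    Tendsto (fun ρ => √ρ * (C + ‖w ρ‖ ^ 2 + D)) l (𝓝 0) := by
  have h0 : Tendsto (fun ρ : ℝ => √ρ) l (𝓝 0) := by
    have h := (Real.continuous_sqrt.tendsto 0).mono_left (hl.trans nhdsWithin_le_nhds)
    rwa [Real.sqrt_zero] at h
  have h2 := h0.mul (((hw.norm.pow 2).const_add C).add_const D)
  rwa [zero_mul] at h2

lemma abs_integral_le_of_abs_le {E : Type} [NormedAddCommGroup E] [InnerProductSpace ℝ E]
    {f D : ℝ → ℝ} {w : L2I T E} (hD : Integrable D (timeMeasure T)) {r k C : ℝ}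
    (hr : 0 ≤ r) (hC : ∫ t in Ioo 0 T, D t ≤ C)
    (h : ∀ᵐ t ∂timeMeasure T, |f t| ≤ r * (D t + ‖w t‖ ^ 2 + k)) :
    |∫ t in Ioo 0 T, f t| ≤
      r * (C + ‖w‖ ^ 2 + volume.real (Ioo 0 T) * k) := by
  have h1 : Integrable (fun t => ‖w t‖ ^ 2) (timeMeasure T) := (Lp.memLp w).norm.integrable_sq
  have h2 := (hD.add h1).add (integrable_const k)
  refine (norm_integral_le_of_norm_le (f := f) (h2.const_mul r) h).trans ?_
  rw [integral_const_mul, integral_add' (hD.add h1) (integrable_const k), integral_add' hD h1,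
    norm_sq_eq_integral, integral_const, measureReal_restrict_apply_univ, smul_eq_mul]
  gcongr

end Limits

/-! ### The limit of the elliptic equation -/

section TruncatedProduct

variable {d : ℕ} {Ω : Opens (EuclideanSpace ℝ (Fin d))} {T : ℝ}

/-- The regularization `φ |u|_ε` of `φ |u|`, with `|v|_ε = (v² + ε²)^{1/2} - ε`, at those times at
which the bound `N` of `φ` and `∇φ` does not exceed `c`, and `0` at the others. -/
def truncProd (hΩ : Bornology.IsBounded (Ω : Set (EuclideanSpace ℝ (Fin d)))) (φ : ℝ → 𝓓(Ω, ℝ))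
    (N : ℝ → ℝ) (c : ℝ) {ε : ℝ} (hε : 0 < ε) (t : ℝ) (u : H01 Ω) : H01 Ω :=
  {t | N t ≤ c}.indicator (fun t => (⟨modPair (isNemytskiiPair_smoothAbs hε)
    (isMultiplier_testFunction (φ t)) u, modPair_mem hΩ (contDiff_smoothAbs hε)
    (isNemytskiiPair_smoothAbs hε) (φ t) u⟩ : H01 Ω)) t

variable {hΩ : Bornology.IsBounded (Ω : Set (EuclideanSpace ℝ (Fin d)))} {φ : ℝ → 𝓓(Ω, ℝ)}
  {N : ℝ → ℝ} {c ε : ℝ} {hε : 0 < ε} {t : ℝ}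

lemma truncProd_of_le (h : N t ≤ c) (u : H01 Ω) :
    truncProd hΩ φ N c hε t u = ⟨modPair (isNemytskiiPair_smoothAbs hε)
      (isMultiplier_testFunction (φ t)) u, modPair_mem hΩ (contDiff_smoothAbs hε)
      (isNemytskiiPair_smoothAbs hε) (φ t) u⟩ :=
  indicator_of_mem (s := {t | N t ≤ c}) h _

lemma truncProd_of_lt (h : c < N t) (u : H01 Ω) : truncProd hΩ φ N c hε t u = 0 :=
  indicator_of_notMem (s := {t | N t ≤ c}) (not_le.2 h) _

lemma fn_zero : H01.fn (0 : H01 Ω) = 0 := rfl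

lemma continuous_truncProd (t : ℝ) : Continuous (truncProd hΩ φ N c hε t) := by
  rcases le_or_gt (N t) c with h | h
  · simp_rw [funext (truncProd_of_le (hΩ := hΩ) (hε := hε) h)]
    exact ((continuous_modPair hΩ _ _ (contDiff_smoothAbs hε).continuous
      ((contDiff_smoothAbs hε).continuous_deriv (by simp))).comp
      continuous_subtype_val).subtype_mk _
  · simp_rw [funext (truncProd_of_lt (hΩ := hΩ) (hε := hε) h)]
    exact continuous_const

lemma norm_truncProd_le (hN : ∀ t x, ‖φ t x‖ ≤ N t ∧
    ‖∇ (φ t : EuclideanSpace ℝ (Fin d) → ℝ) x‖ ≤ N t) (t : ℝ) (u : H01 Ω) :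
    ‖truncProd hΩ φ N c hε t u‖ ≤ 3 * N t * ‖u‖ := by
  rcases le_or_gt (N t) c with h | h
  · rw [truncProd_of_le h]
    exact norm_modPair_le (isNemytskiiPair_smoothAbs hε) (isMultiplier_testFunction (φ t)) (hN t)
      (u : SobolevPair Ω)
  · rw [truncProd_of_lt h, norm_zero]
    have := (norm_nonneg _).trans (hN t 0).1
    positivity

lemma norm_truncProd_le_of_nonneg (hc : 0 ≤ c) (hN : ∀ t x, ‖φ t x‖ ≤ N t ∧
    ‖∇ (φ t : EuclideanSpace ℝ (Fin d) → ℝ) x‖ ≤ N t) (t : ℝ) (u : H01 Ω) :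
    ‖truncProd hΩ φ N c hε t u‖ ≤ 3 * c * ‖u‖ := by
  rcases le_or_gt (N t) c with h | h
  · refine (norm_truncProd_le hN t u).trans ?_
    gcongr
  · rw [truncProd_of_lt h, norm_zero]
    positivity

/-- The function underlying the truncated product is of the form to which
`IsAdjointSolution.abs_apply_le` applies. -/
lemma exists_fn_truncProd (hc : 0 ≤ c) (hN : ∀ t x, ‖φ t x‖ ≤ N t ∧
    ‖∇ (φ t : EuclideanSpace ℝ (Fin d) → ℝ) x‖ ≤ N t) (t : ℝ) (u : H01 Ω) :
    ∃ ψ : EuclideanSpace ℝ (Fin d) → ℝ, (∀ x, |ψ x| ≤ c) ∧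
      (H01.fn (truncProd hΩ φ N c hε t u) =ᵐ[spaceMeasure Ω]
        fun x => ψ x * smoothAbs ε (H01.fn u x)) := by
  rcases le_or_gt (N t) c with h | h
  · refine ⟨φ t, fun x => (hN t x).1.trans h, ?_⟩
    have h1 : H01.fn (truncProd hΩ φ N c hε t u) = (modPair (isNemytskiiPair_smoothAbs hε)
        (isMultiplier_testFunction (φ t)) (u : SobolevPair Ω)).fst :=
      congrArg H01.fn (truncProd_of_le h u)
    rw [h1]
    filter_upwards [modPair_fst (isNemytskiiPair_smoothAbs hε) (isMultiplier_testFunction (φ t))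
      (u : SobolevPair Ω)] with x hx
    rw [hx]
    rfl
  · refine ⟨fun _ => 0, by simpa using hc, ?_⟩
    rw [truncProd_of_lt h, fn_zero]
    filter_upwards [Lp.coeFn_zero ℝ 2 (spaceMeasure Ω)] with x hx
    rw [hx, zero_mul, Pi.zero_apply]

lemma aestronglyMeasurable_truncProd (hφ : IsL2TestFunction T φ) (hN : MemLp N 2 (timeMeasure T))
    (u : L2I T (H01 Ω)) :
    AEStronglyMeasurable (fun t => truncProd hΩ φ N c hε t (u t)) (timeMeasure T) := by
  refine AEStronglyMeasurable.indicator₀ ?_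
    (nullMeasurableSet_le hN.1.aemeasurable aemeasurable_const)
  refine (Topology.IsEmbedding.subtypeVal.aestronglyMeasurable_comp_iff).1 ?_
  exact aestronglyMeasurable_modPair hΩ (isNemytskiiPair_smoothAbs hε)
    (contDiff_smoothAbs hε).continuous ((contDiff_smoothAbs hε).continuous_deriv (by simp))
    (fun t => isMultiplier_testFunction (φ t)) hφ.aestronglyMeasurable
    hφ.aestronglyMeasurable_gradient
    (continuous_subtype_val.comp_aestronglyMeasurable (Lp.aestronglyMeasurable u))

/-- Truncation and regularization are removed simultaneously. -/
lemma tendsto_truncProd (t : ℝ) (u : H01 Ω) {e : ℕ → ℝ} (hpos : ∀ n, 0 < e n)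
    (he : Tendsto e atTop (𝓝 0)) :
    Tendsto (fun n : ℕ => truncProd hΩ φ N n (hpos n) t u) atTop
      (𝓝 ⟨modPair isNemytskiiPair_abs (isMultiplier_testFunction (φ t)) u,
        modPair_abs_mem hΩ (φ t) u⟩) := by
  refine tendsto_subtype_rng.2 ((tendsto_modPair_smoothAbs hΩ
    (isMultiplier_testFunction (φ t)) (u : SobolevPair Ω) hpos he).congr' ?_)
  filter_upwards [tendsto_natCast_atTop_atTop.eventually_ge_atTop (N t)] with n hn
  rw [truncProd_of_le hn]

end TruncatedProduct

section AdjointLimit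

variable {d : ℕ} {Ω : Opens (EuclideanSpace ℝ (Fin d))} {T : ℝ}
  {j₁ : L2I T (H01 Ω) → ℝ} {j₂ : H01 Ω → ℝ} {a : ℝ → ℝ → ℝ} {l : Filter ℝ}
  {zρ : ℝ → H1IStar T (H01 Ω)} {z : H1IStar T (H01 Ω)}
  {qρ : ℝ → H1I T (Hneg Ω)} {ξρ : ℝ → L2I T (H01 Ω)}

/-- Bounds for the adjoint variables that are uniform in `ρ`, since `j₁'` and `j₂'` are continuous
and `z_ρ → z`, `z_ρ(T) → z(T)`. -/
lemma exists_uniform_bound (hd : 1 ≤ d)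
    (hΩ : Bornology.IsBounded (Ω : Set (EuclideanSpace ℝ (Fin d)))) (hT : 0 < T)
    (hj₁ : ContDiff ℝ 1 j₁) (hj₂ : ContDiff ℝ 1 j₂) (ha : IsRegularizedAbs a)
    (hl : l ≤ 𝓝[>] 0) (hz : Tendsto zρ l (𝓝 z))
    (hadj : ∀ᶠ ρ in l, IsAdjointSolution a j₁ j₂ ρ (zρ ρ) (qρ ρ) (ξρ ρ)) :
    ∃ M C : ℝ, ∀ᶠ ρ in l, (∀ᵐ t ∂timeMeasure T, ‖H1I.fn (qρ ρ) t‖ ≤ M) ∧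
      ∫ t in Ioo 0 T, H1I.fn (qρ ρ) t (ξρ ρ t) ≤ C := by
  obtain ⟨G, hG⟩ := exists_inverse_laplacian hd hΩ
  obtain ⟨γ, hγ, hGb⟩ := exists_norm_apply_le (V := H01 Ω) G
  obtain ⟨A, hA0, hA⟩ := exists_eventually_norm_fderiv_le hj₁
    ((continuous_H1IStar_fn.tendsto z).comp hz)
  obtain ⟨K, -, hK⟩ := exists_eventually_norm_fderiv_le hj₂
    ((continuous_integral_L2I.tendsto _).comp ((continuous_H1IStar_dot.tendsto z).comp hz))
  let κ : ℝ := (measureUnivNNReal (timeMeasure T) : ℝ) ^ ((2 : ENNReal).toReal⁻¹)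
  let M : ℝ := 1 + γ * K ^ 2 + 2 * A * γ * κ
  refine ⟨M, γ * K ^ 2 + 2 * A * γ * κ * M, ?_⟩
  filter_upwards [hadj, hl self_mem_nhdsWithin, hA, hK] with ρ h1 h2 h3 h4
  exact h1.energy_estimate hT hG hγ hGb (h1.apply_self_nonneg ha h2) hA0 h3.2 h4.1 rfl rfl

set_option maxHeartbeats 1000000 in
/-- The weak limit of the adjoint variables annihilates the truncated products: these depend
continuously on `ż` in `L²(I; H_0^1(Ω))`, which permits the limit `ρ → 0` in the pairing, and the
pairings with the adjoint variables are of order `√ρ`. -/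
lemma integral_apply_truncProd_eq_zero [l.NeBot]
    (hΩ : Bornology.IsBounded (Ω : Set (EuclideanSpace ℝ (Fin d))))
    (ha : IsRegularizedAbs a)
    (hl : l ≤ 𝓝[>] 0) (hz : Tendsto zρ l (𝓝 z))
    (hadj : ∀ᶠ ρ in l, IsAdjointSolution a j₁ j₂ ρ (zρ ρ) (qρ ρ) (ξρ ρ))
    {M C : ℝ} (hM : ∀ᶠ ρ in l, (∀ᵐ t ∂timeMeasure T, ‖H1I.fn (qρ ρ) t‖ ≤ M) ∧
      ∫ t in Ioo 0 T, H1I.fn (qρ ρ) t (ξρ ρ t) ≤ C)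
    {q : L2I T (Hneg Ω)}
    (hq : ∀ F : StrongDual ℝ (L2I T (Hneg Ω)),
      Tendsto (fun ρ => F (H1I.fn (qρ ρ))) l (𝓝 (F q)))
    {φ : ℝ → 𝓓(Ω, ℝ)} (hφ : IsL2TestFunction T φ) {N : ℝ → ℝ} (hN : MemLp N 2 (timeMeasure T))
    (hφN : ∀ t x, ‖φ t x‖ ≤ N t ∧ ‖∇ (φ t : EuclideanSpace ℝ (Fin d) → ℝ) x‖ ≤ N t)
    {c ε : ℝ} (hc : 0 ≤ c) (hε : 0 < ε) :
    ∫ t in Ioo 0 T, q t (truncProd hΩ φ N c hε t (H1IStar.dot z t)) = 0 := by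
  obtain ⟨S, hS, hSN⟩ := exists_continuous_superposition (T := T)
    (N := truncProd hΩ φ N c hε) (L := 3 * c) continuous_truncProd
    (norm_truncProd_le_of_nonneg hc hφN) (aestronglyMeasurable_truncProd hφ hN)
  have hw : Tendsto (fun ρ => S (H1IStar.dot (zρ ρ))) l (𝓝 (S (H1IStar.dot z))) :=
    (hS.tendsto _).comp ((continuous_H1IStar_dot.tendsto z).comp hz)
  have hR : ∃ R : ℝ, ∀ᶠ ρ in l, ‖H1I.fn (qρ ρ)‖ ≤ R := by
    refine ⟨(measureUnivNNReal (timeMeasure T) : ℝ) ^ ((2 : ENNReal).toReal⁻¹) * max M 0, ?_⟩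
    filter_upwards [hM] with ρ hρ
    exact Lp.norm_le_of_ae_bound (le_max_right _ _)
      (hρ.1.mono fun t ht => ht.trans (le_max_left _ _))
  obtain ⟨R, hR⟩ := hR
  have hlim := tendsto_integral_pairing hq hR hw
  have hsmall : Tendsto (fun ρ => ∫ t in Ioo 0 T, H1I.fn (qρ ρ) t (S (H1IStar.dot (zρ ρ)) t)) l
      (𝓝 0) := by
    have hsqrt := tendsto_sqrt_mul_zero hl hw C (volume.real (Ioo 0 T) *
      (2 * c ^ 2 * volume.real (Ω : Set (EuclideanSpace ℝ (Fin d)))))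
    refine squeeze_zero_norm' ?_ hsqrt
    filter_upwards [hadj, hl self_mem_nhdsWithin, hM] with ρ hsol hρ hρM
    have hae : ∀ᵐ t ∂timeMeasure T, |H1I.fn (qρ ρ) t (S (H1IStar.dot (zρ ρ)) t)| ≤
        √ρ * (H1I.fn (qρ ρ) t (ξρ ρ t) + ‖S (H1IStar.dot (zρ ρ)) t‖ ^ 2 +
          2 * c ^ 2 * volume.real (Ω : Set (EuclideanSpace ℝ (Fin d)))) := by
      filter_upwards [hsol.abs_apply_le hΩ ha hρ (C := c), hSN (H1IStar.dot (zρ ρ))] with t h1 h2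
      obtain ⟨ψ, hψ, hfn⟩ := exists_fn_truncProd (hΩ := hΩ) (hε := hε) hc hφN t
        (H1IStar.dot (zρ ρ) t)
      rw [h2]
      exact h1 _ ψ (smoothAbs ε) hψ (isNemytskiiPair_smoothAbs hε).abs_fst_le hfn
    exact abs_integral_le_of_abs_le (E := H01 Ω) (w := S (H1IStar.dot (zρ ρ)))
      (integrable_pairing (H1I.fn (qρ ρ)) (ξρ ρ)) (Real.sqrt_nonneg ρ) hρM.2 hae
  refine (integral_congr_ae ?_).trans (tendsto_nhds_unique hlim hsmall)
  filter_upwards [hSN (H1IStar.dot z)] with t ht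
  rw [ht]

end AdjointLimit

end RateIndep

end

set_option maxHeartbeats 1000000 in
theorem mainTheorem9 {d : ℕ} (hd : 1 ≤ d) (Ω : Opens (EuclideanSpace ℝ (Fin d)))
    (hΩ : Bornology.IsBounded (Ω : Set (EuclideanSpace ℝ (Fin d))))
    (T : ℝ) (hT : 0 < T)
    (j₁ : RateIndep.L2I T (RateIndep.H01 Ω) → ℝ) (hj₁ : ContDiff ℝ 1 j₁)
    (j₂ : RateIndep.H01 Ω → ℝ) (hj₂ : ContDiff ℝ 1 j₂)
    (a : ℝ → ℝ → ℝ) (ha : RateIndep.IsRegularizedAbs a)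
    (l : Filter ℝ) [l.NeBot] (hl : l ≤ 𝓝[>] 0)
    (zρ : ℝ → RateIndep.H1IStar T (RateIndep.H01 Ω)) (z : RateIndep.H1IStar T (RateIndep.H01 Ω))
    (hz : Tendsto zρ l (𝓝 z))
    (qρ : ℝ → RateIndep.H1I T (RateIndep.Hneg Ω)) (ξρ : ℝ → RateIndep.L2I T (RateIndep.H01 Ω))
    (hadj : ∀ᶠ ρ in l, RateIndep.IsAdjointSolution a j₁ j₂ ρ (zρ ρ) (qρ ρ) (ξρ ρ))
    (q : RateIndep.L2I T (RateIndep.Hneg Ω))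
    (hq : ∀ F : StrongDual ℝ (RateIndep.L2I T (RateIndep.Hneg Ω)),
      Tendsto (fun ρ => F (RateIndep.H1I.fn (qρ ρ))) l (𝓝 (F q)))
    (φ : ℝ → 𝓓(Ω, ℝ)) (hφ : RateIndep.IsL2TestFunction T φ) :
    ∃ w : Lp (RateIndep.H01 Ω) 1 (RateIndep.timeMeasure T),
      (∀ᵐ t ∂(RateIndep.timeMeasure T),
        (RateIndep.H01.fn (w t) : EuclideanSpace ℝ (Fin d) → ℝ) =ᵐ[RateIndep.spaceMeasure Ω]
          fun x => φ t x * |RateIndep.H01.fn (RateIndep.H1IStar.dot z t) x|) ∧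
      Integrable (fun t => q t (w t)) (RateIndep.timeMeasure T) ∧
      ∫ t, q t (w t) ∂(RateIndep.timeMeasure T) = 0 := by
  obtain ⟨N, hN, hφN⟩ := hφ.exists_bound
  obtain ⟨M, C, hM⟩ := RateIndep.exists_uniform_bound hd hΩ hT hj₁ hj₂ ha hl hz hadj
  have hqM := RateIndep.ae_norm_le_of_weak_limit hq (hM.mono fun _ h => h.1)
  -- Regularization parameter `1 / (n + 1)` and truncation level `n` are coupled, so that a single
  -- limit, dominated by `3 N ‖ż‖`, removes both.
  have hpos : ∀ n : ℕ, (0 : ℝ) < 1 / ((n : ℝ) + 1) := fun n => by positivity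
  have hg : Integrable (fun t => 3 * N t * ‖RateIndep.H1IStar.dot z t‖)
      (RateIndep.timeMeasure T) :=
    (hN.const_mul 3).integrable_mul (Lp.memLp (RateIndep.H1IStar.dot z)).norm
  obtain ⟨w, hw, hint, hzero⟩ := RateIndep.exists_toLp_integral_pairing_eq_zero hqM
    (W := fun n t => RateIndep.truncProd hΩ φ N n (hpos n) t (RateIndep.H1IStar.dot z t))
    (fun n => RateIndep.aestronglyMeasurable_truncProd hφ hN _) hg
    (fun n t => RateIndep.norm_truncProd_le hφN t _)
    (fun t => RateIndep.tendsto_truncProd t _ hpos tendsto_one_div_add_atTop_nhds_zero_nat)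
    (fun n => RateIndep.integral_apply_truncProd_eq_zero hΩ ha hl hz hadj hM hq hφ hN hφN
      n.cast_nonneg (hpos n))
  refine ⟨w, ?_, hint, hzero⟩
  filter_upwards [hw] with t ht
  rw [ht]
  exact RateIndep.modPair_fst RateIndep.isNemytskiiPair_abs
    (RateIndep.isMultiplier_testFunction (φ t)) _
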